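/- Let $k$ be an algebraically closed field, let $r\ge 1$ be an integer, and let $\xi\in k$ be a primitive $r$-th root of unity. Let $$T_r=k\langle g,x\rangle/(g^r-1,\ gx-\xi xg),$$ and let $\mathfrak A$ be the category of left $T_r$-modules that are finite-dimensional over $k$ and $x$-nilpotent (i.e. annihilated by some power of $x$); it is a $k$-linear abelian category. Then the Frobenius–Perron dimension of $\mathfrak A$ is $1$: $$\operatorname{fpdim}\mathfrak A=\sup_{\phi}\ \rho\Big(\big(\dim_k\operatorname{Ext}^1_{\mathfrak A}(X_i,X_j)\big)_{1\le i,j\le n}\Big)=1 .$$ Here the supremum is over all $n\ge 1$ and all brick sets $\phi=\{X_1,\dots,X_n\}$ in $\mathfrak A$, that is, sets of $n$ objects with $\operatorname{Hom}_{\mathfrak A}(X_i,X_i)=k$ for all $i$ and $\dim_k\operatorname{Hom}_{\mathfrak A}(X_i,X_j)=\delta_{ij}$ for all $i,j$; and $\rho$ is the spectral radius, i.e. the largest absolute value of a complex eigenvalue (if some entries of the matrix are infinite, they are replaced by real variables, and $\rho$ is the lower limit of the spectral radii as all these variables tend to $+\infty$). -/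

import Mathlib

open CategoryTheory

universe u v w

noncomputable section

namespace FrobeniusPerron

/-! ### Spectral radius of a matrix with entries in `ℕ ∪ {∞}` -/

/-- Replace the infinite entries of `A` by the variables `x i j`. -/
def substInfinity {n : ℕ} (A : Matrix (Fin n) (Fin n) ℕ∞) (x : Fin n → Fin n → ℝ) :
    Matrix (Fin n) (Fin n) ℂ :=
  Matrix.of fun i j => if A i j = ⊤ then ((x i j : ℝ) : ℂ) else ((A i j).toNat : ℂ)

/-- The spectral radius of a square matrix with entries in `ℕ ∪ {∞}`: the lower limit of the usual
spectral radius (over `ℂ`) of the matrices obtained by replacing the infinite entries by real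
numbers `x i j`, as all the `x i j` tend to `∞`. For a matrix with finite entries this is the
largest absolute value of a complex eigenvalue. -/
def matrixSpectralRadius {n : ℕ} (A : Matrix (Fin n) (Fin n) ℕ∞) : ENNReal :=
  Filter.liminf (fun x : Fin n → Fin n → ℝ => spectralRadius ℂ (substInfinity A x)) Filter.atTop

/-! ### Frobenius-Perron dimension of an abelian category -/

section Category

variable (k : Type w) [Field k] {C : Type u} [Category.{v} C] [Abelian C] [Linear k C]

/-- The dimension over `k` of `Hom(X, Y)`, as an element of `ℕ ∪ {∞}`. -/
def homDim (X Y : C) : ℕ∞ :=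
  Cardinal.toENat (Module.rank k (X ⟶ Y))

/-- The dimension over `k` of `Ext^n(X, Y)` in the abelian category `C`,
as an element of `ℕ ∪ {∞}`. -/
def extDim (n : ℕ) (X Y : C) : ℕ∞ :=
  letI := HasExt.standard C
  Cardinal.toENat (Module.rank k (Abelian.Ext X Y n))

/-- An object `M` is a brick if `Hom(M, M) = k`, i.e. every endomorphism of `M` is `c • 𝟙 M` for a
unique scalar `c`. -/
def IsBrick (M : C) : Prop :=
  Function.Bijective fun c : k => c • 𝟙 M

/-- `{X 0, …, X (n-1)}` is a brick set: each `X i` is a brick and `dim Hom(X i, X j) = δ_{ij}`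
(so that the `X i` are nonzero and pairwise distinct). -/
def IsBrickSet {n : ℕ} (X : Fin n → C) : Prop :=
  (∀ i, IsBrick k (X i)) ∧ ∀ i j, homDim k (X i) (X j) = if i = j then 1 else 0

/-- The adjacency matrix `(dim Ext^m(X i, X j))_{ij}` of the family `X` for the functor `Ext^m`. -/
def extAdjacencyMatrix (m : ℕ) {n : ℕ} (X : Fin n → C) : Matrix (Fin n) (Fin n) ℕ∞ :=
  Matrix.of fun i j => extDim k m (X i) (X j)

variable (C)

/-- The `n`-th Frobenius-Perron dimension of `Ext^m` on `C`: the supremum of the spectral radii of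
the adjacency matrices of all brick sets with `n` elements (and `0` if there are none). -/
def fpdimExt (n m : ℕ) : ENNReal :=
  ⨆ (X : Fin n → C) (_ : IsBrickSet k X), matrixSpectralRadius (extAdjacencyMatrix k m X)

/-- The Frobenius-Perron dimension of the abelian category `C`, that is, of `Ext^1` on `C`. The
supremum is over all nonempty finite brick sets. -/
def fpdim : ENNReal :=
  ⨆ (n : ℕ) (_ : 1 ≤ n), fpdimExt k C n 1

end Category

/-! ### The algebra `T_r` and its finite-dimensional `x`-nilpotent modules -/

/-- The two generators. -/
inductive Gen : Type
  | g
  | x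

variable (k : Type u) [Field k] (r : ℕ) (ξ : k)

/-- The defining relations `g ^ r = 1` and `g x = ξ x g`. -/
inductive TRel : FreeAlgebra k Gen → FreeAlgebra k Gen → Prop
  | g_pow : TRel (FreeAlgebra.ι k Gen.g ^ r) 1
  | g_mul_x : TRel (FreeAlgebra.ι k Gen.g * FreeAlgebra.ι k Gen.x)
      (ξ • (FreeAlgebra.ι k Gen.x * FreeAlgebra.ι k Gen.g))

/-- The algebra `T_r = k⟨g, x⟩ / (g ^ r - 1, g x - ξ x g)`. -/
abbrev TAlgebra : Type u :=
  RingQuot (TRel k r ξ)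

/-- The image of the generator `x` in `T_r`. -/
def TAlgebra.x : TAlgebra k r ξ :=
  RingQuot.mkAlgHom k (TRel k r ξ) (FreeAlgebra.ι k Gen.x)

open scoped ModuleCat in
/-- The left `T_r`-modules `M` that are finite-dimensional over `k` and `x`-nilpotent, i.e. a power
of `x` annihilates `M`. -/
def isFinDimXNilpotent : ObjectProperty (ModuleCat.{u} (TAlgebra k r ξ)) := fun M =>
  Module.Finite k M ∧ ∃ n : ℕ, ∀ m : M, (TAlgebra.x k r ξ) ^ n • m = 0

variable {k r ξ} in
open scoped ModuleCat in
lemma isFinDimXNilpotent_of_injective {M N : ModuleCat.{u} (TAlgebra k r ξ)} (f : M ⟶ N)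
    (hf : Function.Injective f.hom) (hN : isFinDimXNilpotent k r ξ N) :
    isFinDimXNilpotent k r ξ M := by
  obtain ⟨h1, n, hn⟩ := hN
  refine ⟨Module.Finite.of_injective (f.hom.restrictScalars k) hf, n, fun m => hf ?_⟩
  rw [map_smul, hn, map_zero]

variable {k r ξ} in
open scoped ModuleCat in
lemma isFinDimXNilpotent_of_surjective {M N : ModuleCat.{u} (TAlgebra k r ξ)} (f : M ⟶ N)
    (hf : Function.Surjective f.hom) (hM : isFinDimXNilpotent k r ξ M) :
    isFinDimXNilpotent k r ξ N := by
  obtain ⟨h1, n, hn⟩ := hM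
  refine ⟨Module.Finite.of_surjective (f.hom.restrictScalars k) hf, n, fun m => ?_⟩
  obtain ⟨m, rfl⟩ := hf m
  rw [← map_smul, hn, map_zero]

/-- Finite-dimensional `x`-nilpotent modules form a Serre class in the category of all modules;
in particular they form an abelian category. -/
instance : (isFinDimXNilpotent k r ξ).IsSerreClass where
  exists_zero := by
    refine ⟨ModuleCat.of _ PUnit, ModuleCat.isZero_of_subsingleton _, ?_, 0, fun m => ?_⟩
    · let := ModuleCat.moduleOfAlgebraModule (k := k) (ModuleCat.of (TAlgebra k r ξ) PUnit.{u + 1})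
      exact Module.Finite.of_finite
    · exact Subsingleton.elim _ _
  prop_of_mono f _ h := isFinDimXNilpotent_of_injective f ((ModuleCat.mono_iff_injective f).1 ‹_›) h
  prop_of_epi f _ h := isFinDimXNilpotent_of_surjective f ((ModuleCat.epi_iff_surjective f).1 ‹_›) h
  prop_X₂_of_shortExact := by
    open scoped ModuleCat in
    intro S hS h₁ h₃
    obtain ⟨h1, n, hn⟩ := h₁
    obtain ⟨h3, m, hm⟩ := h₃
    have hex : Function.Exact S.f.hom S.g.hom := by
      exact (ShortComplex.ShortExact.moduleCat_exact_iff_function_exact S).1 hS.exact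
    refine ⟨?_, n + m, fun z => ?_⟩
    · exact Module.Finite.of_exact (f := S.f.hom.restrictScalars k)
        (g := S.g.hom.restrictScalars k) hex ((ModuleCat.epi_iff_surjective S.g).1 hS.epi_g)
    · have : S.g.hom ((TAlgebra.x k r ξ) ^ m • z) = 0 := by rw [map_smul, hm]
      obtain ⟨y, hy⟩ := (hex _).1 this
      rw [pow_add, mul_smul, ← hy, ← map_smul, hn, map_zero]

instance : (isFinDimXNilpotent k r ξ).IsClosedUnderBinaryProducts where
  limitsOfShape_le := by
    rintro X ⟨p⟩
    refine (isFinDimXNilpotent k r ξ).prop_of_iso ?_ ((isFinDimXNilpotent k r ξ).prop_biprod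
      (p.prop_diag_obj (.mk .left)) (p.prop_diag_obj (.mk .right)))
    exact (Limits.biprod.isoProd _ _) ≪≫ Limits.IsLimit.conePointUniqueUpToIso
      (Limits.prodIsProd _ _)
      ((Limits.IsLimit.postcomposeHomEquiv (Limits.diagramIsoPair p.diag) _).2 p.isLimit)

instance : (isFinDimXNilpotent k r ξ).IsClosedUnderFiniteProducts := .mk'

/-- The category of finite-dimensional `x`-nilpotent left `T_r`-modules: the full subcategory of
the category of left `T_r`-modules. -/
abbrev FinDimXNilpotent : Type (u + 1) :=
  (isFinDimXNilpotent k r ξ).FullSubcategory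

end FrobeniusPerron

end

/-! Since `ξ ^ r = 1`, the element `x ^ r` is central, so it acts on a brick by a scalar, and
nilpotence makes that scalar `0`. A module of Loewy length at most `r` has a uniserial module of
maximal length as a direct summand. Hence a brick is uniserial: it is generated by a `g`-eigenvector
`v` of weight `μ`, with basis `x ^ i • v` for `i < l`, where `l ≤ r` (`exists_isGenerator`). The
weights `ξ ^ i * μ` of this basis are distinct, so homogeneous elements and maps can be read off
from weights.

For the upper bound, let `X` be such a brick. Every class in `Ext¹(X, Y)` dies on a sufficiently
long uniserial cover of `X`, so it comes from a map to `Y` from the kernel of that cover, which is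
generated in weight `ξ ^ l * μ`. If `Y` is `X` or a brick orthogonal to it, a nonzero class must
send this generator to a nonzero multiple of the top generator of `Y`. Thus `Ext¹(X, Y)` is at most
a line, and is nonzero only if the top of `Y` has weight `ξ ^ l * μ` (`ext_of_isGenerator`). Two
members of a brick set cannot share a top weight, because the longer would map onto the shorter. So
each row of the adjacency matrix has sum at most `1` (`sum_extDim_le_one`), and Gershgorin's theorem
bounds the spectral radius.

For the lower bound, the uniserial module of length `r` and top weight `1` is a brick, and the
uniserial module of length `2r` is a nonsplit self-extension of it (`exists_ext_cyclicObj_ne_zero`).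
Its adjacency matrix is `(1)`. -/

noncomputable section

namespace FrobeniusPerron

/-! ### Effaceability of `Ext¹`; bounds for the spectral radius. -/

section EffaceabilityAndSpectralRadius

open Abelian Limits

/-- In degree `0` the homology of `K` is the cokernel of its incoming differential, and that of `L`
is `L.X 0` itself. So `s.f 0` is a cokernel projection followed by an isomorphism. -/
lemma epi_f_of_quasiIso {C : Type u} [Category.{v} C] [Abelian C] {K L : CochainComplex C ℤ}
    [K.IsStrictlyLE 0] [L.IsStrictlyLE 0] [L.IsStrictlyGE 0] (s : K ⟶ L) [QuasiIso s] :
    Epi (s.f 0) := by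
  have hK : IsIso (K.homologyι 0) := K.isIso_homologyι 0 1 (by simp)
    ((K.isZero_of_isStrictlyLE 0 1 (by lia)).eq_of_tgt _ _)
  have hL : IsIso (L.homologyι 0) := L.isIso_homologyι 0 1 (by simp)
    ((L.isZero_of_isStrictlyLE 0 1 (by lia)).eq_of_tgt _ _)
  have hL' : IsIso (L.pOpcycles 0) := L.isIso_pOpcycles (-1) 0 (by simp)
    ((L.isZero_of_isStrictlyGE 0 (-1) (by lia)).eq_of_src _ _)
  have h1 : IsIso (HomologicalComplex.opcyclesMap s 0) := by
    have h2 : HomologicalComplex.opcyclesMap s 0 =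
        inv (K.homologyι 0) ≫ HomologicalComplex.homologyMap s 0 ≫ L.homologyι 0 := by
      rw [HomologicalComplex.homologyι_naturality s 0, IsIso.inv_hom_id_assoc]
    rw [h2]
    infer_instance
  have h3 : s.f 0 = K.pOpcycles 0 ≫ HomologicalComplex.opcyclesMap s 0 ≫ inv (L.pOpcycles 0) := by
    rw [HomologicalComplex.p_opcyclesMap_assoc, IsIso.hom_inv_id, Category.comp_id]
  rw [h3]
  infer_instance

open DerivedCategory in
/-- Every class in `Ext¹(X, Y)` is killed by the pullback along some epimorphism to `X`. -/
lemma exists_epi_comp_ext_eq_zero {C : Type u} [Category.{v} C] [Abelian C] [HasExt.{w} C]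
    {X Y : C} (e : Ext X Y 1) :
    ∃ (E : C) (p : E ⟶ X) (_ : Epi p), (Ext.mk₀ p).comp e (zero_add 1) = 0 := by
  let := HasDerivedCategory.standard C
  let SX := (CochainComplex.singleFunctor C 0).obj X
  let SY := (CochainComplex.singleFunctor C 0).obj Y
  let φ : Q.obj SX ⟶ Q.obj (SY⟦(1 : ℤ)⟧) := e.hom ≫ (Q.commShiftIso (1 : ℤ)).inv.app SY
  -- The class is a roof `X ← K → Y[1]` with `K` in degrees `≤ 0`; the epimorphism sought is `s` in
  -- degree `0`.
  obtain ⟨K, hK, s, hs, g, hg⟩ := right_fac_of_isStrictlyLE φ 0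
  have hqs : QuasiIso s := by rwa [← isIso_Q_map_iff_quasiIso]
  have hepi := epi_f_of_quasiIso s
  let i : (CochainComplex.singleFunctor C 0).obj (K.X 0) ⟶ K :=
    HomologicalComplex.mkHomFromSingle (𝟙 _)
      (fun j hj => (K.isZero_of_isStrictlyLE 0 j (by simp at hj; lia)).eq_of_tgt _ _)
  obtain ⟨p, hp⟩ := (CochainComplex.singleFunctor C 0).map_surjective (i ≫ s)
  -- The source is concentrated in degree `0` and the target in degree `-1`.
  have hig : i ≫ g = 0 := by
    have hY : (SY⟦(1 : ℤ)⟧).IsStrictlyLE (-1) :=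
        CochainComplex.isStrictlyLE_shift _ 0 _ _ (by lia)
    ext j
    by_cases hj : j = 0
    · exact ((SY⟦(1 : ℤ)⟧).isZero_of_isStrictlyLE (-1) j (by lia)).eq_of_tgt _ _
    · by_cases hj' : j < 0
      · exact (((CochainComplex.singleFunctor C 0).obj (K.X 0)).isZero_of_isStrictlyGE 0 j
          hj').eq_of_src _ _
      · exact ((SY⟦(1 : ℤ)⟧).isZero_of_isStrictlyLE (-1) j (by lia)).eq_of_tgt _ _
  have hp0 : ((CochainComplex.singleFunctor C 0).map p).f 0 =
      (i ≫ s).f 0 := by rw [hp]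
  refine ⟨K.X 0, p, ?_, ?_⟩
  · have h1 : Epi (((CochainComplex.singleFunctor C 0).map p).f 0) := by
      rw [hp0, HomologicalComplex.comp_f, HomologicalComplex.mkHomFromSingle_f, Category.comp_id]
      exact epi_comp' (@IsIso.epi_of_iso _ _ _ _ _ (Iso.isIso_hom _)) hepi
    have h2 : ((CochainComplex.singleFunctor C 0).map p).f 0 =
      (HomologicalComplex.singleObjXSelf (.up ℤ) 0 (K.X 0)).hom ≫ p ≫
        (HomologicalComplex.singleObjXSelf (.up ℤ) 0 X).inv := 
      HomologicalComplex.single_map_f_self (c := .up ℤ) 0 p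
    rw [h2] at h1
    have h3 := @epi_of_epi _ _ _ _ _ _ _ h1
    have h4 : p = (p ≫ (HomologicalComplex.singleObjXSelf (.up ℤ) 0 X).inv) ≫
      (HomologicalComplex.singleObjXSelf (.up ℤ) 0 X).hom := by simp
    rw [h4]
    exact epi_comp' h3 inferInstance
  · ext
    rw [Ext.comp_hom, Ext.mk₀_hom, ShiftedHom.mk₀_comp, Ext.zero_hom]
    have h1 : Q.map ((CochainComplex.singleFunctor C 0).map p) ≫ φ = 0 := by
      rw [hg, hp, Functor.map_comp, Category.assoc, IsIso.hom_inv_id_assoc, ← Functor.map_comp,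
        hig, Functor.map_zero]
    have h2 : (Q.map ((CochainComplex.singleFunctor C 0).map p) ≫ e.hom) ≫
        (Q.commShiftIso (1 : ℤ)).inv.app SY = 0 := by
      rw [← h1]; exact Category.assoc _ _ _
    exact (cancel_mono ((Q.commShiftIso (1 : ℤ)).inv.app SY)).1 (h2.trans zero_comp.symm)

lemma substInfinity_eq {n : ℕ} {A : Matrix (Fin n) (Fin n) ℕ∞} (h : ∀ i j, A i j ≠ ⊤)
    (x : Fin n → Fin n → ℝ) :
    substInfinity A x = Matrix.of fun i j => ((A i j).toNat : ℂ) := by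
  ext i j
  simp [substInfinity, h]

lemma matrixSpectralRadius_eq {n : ℕ} {A : Matrix (Fin n) (Fin n) ℕ∞} (h : ∀ i j, A i j ≠ ⊤) :
    matrixSpectralRadius A =
      spectralRadius ℂ (Matrix.of fun i j => ((A i j).toNat : ℂ)) := by
  simp [matrixSpectralRadius, substInfinity_eq h]

/-- Gershgorin: the eigenvalue lies in a disc centred at some `A i i` whose radius is the sum of the
norms of the other entries of row `i`. -/
lemma norm_le_one_of_mem_spectrum {ι : Type*} [Fintype ι] [DecidableEq ι] {A : Matrix ι ι ℂ}
    (h : ∀ i, ∑ j, ‖A i j‖ ≤ 1) {z : ℂ} (hz : z ∈ spectrum ℂ A) : ‖z‖ ≤ 1 := by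
  rw [← Matrix.spectrum_toLin', ← Module.End.hasEigenvalue_iff_mem_spectrum] at hz
  obtain ⟨i, hi⟩ := eigenvalue_mem_ball hz
  rw [Metric.mem_closedBall, dist_eq_norm] at hi
  have h1 : ‖z‖ ≤ ‖z - A i i‖ + ‖A i i‖ := by
    simpa using norm_add_le (z - A i i) (A i i)
  have h2 := Finset.sum_erase_add Finset.univ (fun j => ‖A i j‖) (Finset.mem_univ i)
  linarith [h i]

lemma matrixSpectralRadius_le_one {n : ℕ} {A : Matrix (Fin n) (Fin n) ℕ∞}
    (h : ∀ i, ∑ j, A i j ≤ 1) : matrixSpectralRadius A ≤ 1 := by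
  have hA (i j) : A i j ≠ ⊤ := by
    intro hij
    have := (Finset.single_le_sum (f := fun j => A i j) (fun _ _ => zero_le)
      (Finset.mem_univ j)).trans (h i)
    simp [hij] at this
  rw [matrixSpectralRadius_eq hA, spectralRadius]
  refine iSup₂_le fun z hz => ?_
  have := norm_le_one_of_mem_spectrum (A := Matrix.of fun i j => ((A i j).toNat : ℂ)) (fun i => ?_) hz
  · exact_mod_cast this
  · have h1 : (∑ j, ((A i j).toNat : ℕ∞)) ≤ 1 := by
      simpa [ENat.natCast_toNat (hA i _)] using h i
    have h2 : ∑ j, (A i j).toNat ≤ 1 := by exact_mod_cast h1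
    simpa using (by exact_mod_cast h2 : (∑ j, ((A i j).toNat : ℝ)) ≤ 1)

lemma one_le_matrixSpectralRadius {A : Matrix (Fin 1) (Fin 1) ℕ∞} (h : A 0 0 = 1) :
    1 ≤ matrixSpectralRadius A := by
  have hA : ∀ i j, A i j = 1 := fun i j => by
    rw [Subsingleton.elim i 0, Subsingleton.elim j 0, h]
  rw [matrixSpectralRadius_eq (by simp [hA])]
  have h1 : (Matrix.of fun i j => ((A i j).toNat : ℂ)) = 1 := by
    ext i j
    rw [Subsingleton.elim i 0, Subsingleton.elim j 0]
    simp [hA]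
  rw [h1, spectrum.spectralRadius_one]

end EffaceabilityAndSpectralRadius

/-! ### Eigenvectors of `g` and the action of `x` on them. -/

section Modules

variable {k : Type u} [Field k] {r : ℕ} {ξ : k}

variable (k r ξ) in
/-- The image of the generator `g` in `T_r`. -/
def TAlgebra.g : TAlgebra k r ξ :=
  RingQuot.mkAlgHom k (TRel k r ξ) (FreeAlgebra.ι k Gen.g)

open TAlgebra

lemma TAlgebra.g_pow : g k r ξ ^ r = 1 := by
  have := RingQuot.mkAlgHom_rel k (TRel.g_pow (k := k) (r := r) (ξ := ξ))
  simpa [g] using this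

lemma TAlgebra.g_mul_x : g k r ξ * x k r ξ = ξ • (x k r ξ * g k r ξ) := by
  have := RingQuot.mkAlgHom_rel k (TRel.g_mul_x (k := k) (r := r) (ξ := ξ))
  simpa [g, x] using this

lemma TAlgebra.induction {p : TAlgebra k r ξ → Prop} (hk : ∀ c, p (algebraMap k _ c))
    (hg : p (g k r ξ)) (hx : p (x k r ξ)) (hmul : ∀ a b, p a → p b → p (a * b))
    (hadd : ∀ a b, p a → p b → p (a + b)) (t : TAlgebra k r ξ) : p t := by
  obtain ⟨t, rfl⟩ := RingQuot.mkAlgHom_surjective k (TRel k r ξ) t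
  induction t using FreeAlgebra.induction with
  | grade0 c => simpa using hk c
  | grade1 y =>
    cases y
    · exact hg
    · exact hx
  | mul a b ha hb => simpa using hmul _ _ ha hb
  | add a b ha hb => simpa using hadd _ _ ha hb

set_option linter.unusedSectionVars false

variable {M N : Type*} [AddCommGroup M] [Module k M] [Module (TAlgebra k r ξ) M]
  [IsScalarTower k (TAlgebra k r ξ) M] [AddCommGroup N] [Module k N] [Module (TAlgebra k r ξ) N]
  [IsScalarTower k (TAlgebra k r ξ) N]

lemma smul_mem_of_gen_smul_mem {W : Submodule k M} (hg : ∀ m ∈ W, g k r ξ • m ∈ W)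
    (hx : ∀ m ∈ W, x k r ξ • m ∈ W) (t : TAlgebra k r ξ) : ∀ m ∈ W, t • m ∈ W := by
  induction t using TAlgebra.induction with
  | hk c => intro m hm; rw [algebraMap_smul]; exact W.smul_mem c hm
  | hg => exact hg
  | hx => exact hx
  | hmul a b ha hb => intro m hm; rw [mul_smul]; exact ha _ (hb _ hm)
  | hadd a b ha hb => intro m hm; rw [add_smul]; exact W.add_mem (ha _ hm) (hb _ hm)

/-- A `k`-linear map commuting with the generators is `T_r`-linear. -/
def linearMapOfGen (f : M →ₗ[k] N) (hg : ∀ m, f (g k r ξ • m) = g k r ξ • f m)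
    (hx : ∀ m, f (x k r ξ • m) = x k r ξ • f m) : M →ₗ[TAlgebra k r ξ] N where
  toFun := f
  map_add' := map_add f
  map_smul' t := by
    simp only [RingHom.id_apply]
    induction t using TAlgebra.induction with
    | hk c => intro m; rw [algebraMap_smul, algebraMap_smul, map_smul]
    | hg => exact hg
    | hx => exact hx
    | hmul a b ha hb => intro m; rw [mul_smul, mul_smul, ha, hb]
    | hadd a b ha hb => intro m; rw [add_smul, add_smul, map_add, ha, hb]

variable (r ξ) in
lemma smul_comm_scalar (t : TAlgebra k r ξ) (c : k) (m : M) : t • c • m = c • t • m := by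
  rw [← algebraMap_smul (TAlgebra k r ξ) c m, ← algebraMap_smul (TAlgebra k r ξ) c (t • m),
    ← mul_smul, ← mul_smul, Algebra.commutes]

lemma g_smul_x_smul (m : M) : g k r ξ • x k r ξ • m = ξ • x k r ξ • g k r ξ • m := by
  rw [← mul_smul, g_mul_x, smul_assoc, mul_smul]

lemma g_smul_x_pow_smul {v : M} {μ : k} (hv : g k r ξ • v = μ • v) (i : ℕ) :
    g k r ξ • x k r ξ ^ i • v = (ξ ^ i * μ) • x k r ξ ^ i • v := by
  induction i with
  | zero => simp [hv]
  | succ i ih =>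
    rw [pow_succ', mul_smul, g_smul_x_smul, ih, smul_comm_scalar, smul_smul]
    ring_nf

lemma g_pow_smul {v : M} {μ : k} (hv : g k r ξ • v = μ • v) (i : ℕ) :
    g k r ξ ^ i • v = μ ^ i • v := by
  induction i with
  | zero => simp
  | succ i ih => rw [pow_succ', mul_smul, ih, smul_comm_scalar, hv, smul_smul, pow_succ]

/-- The span of the `x ^ i • v` is stable under both generators, since `g` scales each of these
vectors and `x` shifts them. -/
lemma exists_smul_eq_sum {v : M} {μ : k} (hv : g k r ξ • v = μ • v) {l : ℕ}
    (hl : x k r ξ ^ l • v = 0) (t : TAlgebra k r ξ) :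
    ∃ c : ℕ → k, t • v = ∑ i ∈ Finset.range l, c i • x k r ξ ^ i • v := by
  have hl' : ∀ i, l ≤ i → x k r ξ ^ i • v = 0 := fun i hi => by
    rw [← Nat.sub_add_cancel hi, pow_add, mul_smul, hl, smul_zero]
  let W : Submodule k M := Submodule.span k ((fun i => x k r ξ ^ i • v) '' (Finset.range l))
  have hW (i : ℕ) : x k r ξ ^ i • v ∈ W := by
    by_cases hi : i < l
    · exact Submodule.subset_span ⟨i, by simpa using hi, rfl⟩
    · rw [hl' i (not_lt.1 hi)]; exact W.zero_mem
  have key : t • v ∈ W := by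
    refine smul_mem_of_gen_smul_mem (fun m hm => ?_) (fun m hm => ?_) t v (by simpa using hW 0)
    all_goals induction hm using Submodule.span_induction with
      | zero => rw [smul_zero]; exact W.zero_mem
      | add a b _ _ ha hb => rw [smul_add]; exact W.add_mem ha hb
      | smul c a _ ha => rw [smul_comm_scalar]; exact W.smul_mem c ha
      | mem a ha =>
        obtain ⟨i, -, rfl⟩ := ha
        first
        | (dsimp only; rw [g_smul_x_pow_smul hv]; exact W.smul_mem _ (hW i))
        | (dsimp only; rw [← mul_smul, ← pow_succ']; exact hW (i + 1))
  obtain ⟨c, hc⟩ := (Submodule.mem_span_image_finset_iff_exists_fun k).1 key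
  refine ⟨fun i => if h : i ∈ Finset.range l then c ⟨i, h⟩ else 0, ?_⟩
  rw [← hc, ← Finset.sum_coe_sort (Finset.range l) fun i =>
    (if h : i ∈ Finset.range l then c ⟨i, h⟩ else 0) • x k r ξ ^ i • v]
  exact Finset.sum_congr rfl fun i _ => by simp only [dif_pos i.2]

/-! ### Projectors onto the eigenspaces of `g` -/

variable (r ξ) in
/-- The projector onto the `μ`-eigenspace of `g`, when `μ ^ r = 1`. -/
def eigenProj (μ : k) : TAlgebra k r ξ :=
  ((r : k)⁻¹) • ∑ j ∈ Finset.range r, (μ⁻¹) ^ j • g k r ξ ^ j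

lemma g_mul_eigenProj (hr : r ≠ 0) {μ : k} (hμ : μ ^ r = 1) :
    g k r ξ * eigenProj r ξ μ = μ • eigenProj r ξ μ := by
  have hμ0 : μ ≠ 0 := by rintro rfl; simp [hr] at hμ
  rw [eigenProj, mul_smul_comm, smul_comm μ, Finset.mul_sum, Finset.smul_sum]
  obtain ⟨s, rfl⟩ : ∃ s, r = s + 1 := Nat.exists_eq_succ_of_ne_zero hr
  have h1 : ∀ j, g k (s+1) ξ * (μ⁻¹ ^ j • g k (s+1) ξ ^ j) =
      μ • (μ⁻¹ ^ (j + 1) • g k (s+1) ξ ^ (j + 1)) := fun j => by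
    rw [mul_smul_comm, ← pow_succ', smul_smul, pow_succ' μ⁻¹, mul_inv_cancel_left₀ hμ0]
  simp only [h1]
  rw [← Finset.smul_sum, ← Finset.smul_sum, Finset.sum_range_succ, Finset.sum_range_succ',
    g_pow, inv_pow, hμ]
  simp

lemma g_smul_eigenProj_smul (hr : r ≠ 0) {μ : k} (hμ : μ ^ r = 1) (m : M) :
    g k r ξ • eigenProj r ξ μ • m = μ • eigenProj r ξ μ • m := by
  rw [← mul_smul, g_mul_eigenProj hr hμ, smul_assoc]

lemma eigenProj_smul (v : M) (μ : k) : eigenProj r ξ μ • v =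
    (r : k)⁻¹ • ∑ j ∈ Finset.range r, μ⁻¹ ^ j • g k r ξ ^ j • v := by
  simp only [eigenProj, smul_assoc, Finset.sum_smul]

lemma eigenProj_smul_self (hr : (r : k) ≠ 0) {v : M} {μ : k} (hμ : μ ≠ 0)
    (hv : g k r ξ • v = μ • v) : eigenProj r ξ μ • v = v := by
  rw [eigenProj_smul]
  simp only [g_pow_smul hv, smul_smul, ← mul_pow, inv_mul_cancel₀ hμ, one_pow, one_smul]
  rw [Finset.sum_const, Finset.card_range, ← Nat.cast_smul_eq_nsmul k, smul_smul,
    inv_mul_cancel₀ hr, one_smul]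

lemma eigenProj_smul_of_ne {v : M} {μ ν : k} (hμ : μ ^ r = 1) (hν : ν ^ r = 1)
    (h : ν ≠ μ) (hv : g k r ξ • v = ν • v) : eigenProj r ξ μ • v = 0 := by
  rw [eigenProj_smul]
  simp only [g_pow_smul hv, smul_smul, ← mul_pow]
  rw [← Finset.sum_smul]
  by_cases hr : r = 0
  · simp [hr]
  have hμ0 : μ ≠ 0 := by rintro rfl; simp [hr] at hμ
  have h1 : μ⁻¹ * ν ≠ 1 := fun h2 => h (by rw [← mul_inv_cancel_left₀ hμ0 ν, h2, mul_one])
  have h2 : ∑ j ∈ Finset.range r, (μ⁻¹ * ν) ^ j = 0 := by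
    have := mul_neg_geom_sum (μ⁻¹ * ν) r
    rw [mul_pow, inv_pow, hμ, hν, inv_one, mul_one, sub_self] at this
    exact (mul_eq_zero.1 this).resolve_left (sub_ne_zero.2 (Ne.symm h1))
  rw [h2, zero_smul, smul_zero]

/-- The existence of a primitive `r`-th root makes `r` invertible in `k`; in the coefficient of `g ^
j` with `0 < j < r`, a full geometric sum of roots of unity vanishes. -/
lemma sum_eigenProj (hξ : IsPrimitiveRoot ξ r) (hr : r ≠ 0) :
    ∑ c ∈ Finset.range r, eigenProj r ξ (ξ ^ c) = 1 := by
  have : NeZero r := ⟨hr⟩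
  have hrk : (r : k) ≠ 0 := hξ.neZero'.out
  simp only [eigenProj]
  rw [← Finset.smul_sum, Finset.sum_comm]
  have h1 : ∀ j ∈ Finset.range r, ∑ c ∈ Finset.range r, (ξ ^ c)⁻¹ ^ j • g k r ξ ^ j =
      if j = 0 then (r : k) • (1 : TAlgebra k r ξ) else 0 := fun j hj => by
    rw [← Finset.sum_smul]
    split_ifs with h0
    · simp [h0]
    · have h2 : (ξ⁻¹) ^ j ≠ 1 := hξ.inv.pow_ne_one_of_pos_of_lt h0 (Finset.mem_range.1 hj)
      have h3 := mul_neg_geom_sum ((ξ⁻¹) ^ j) r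
      rw [pow_right_comm, hξ.inv.pow_eq_one, one_pow, sub_self] at h3
      have h4 : ∑ c ∈ Finset.range r, (ξ ^ c)⁻¹ ^ j = 0 := by
        rw [← (mul_eq_zero.1 h3).resolve_left (sub_ne_zero.2 (Ne.symm h2))]
        refine Finset.sum_congr rfl fun c _ => ?_
        rw [← inv_pow, ← pow_mul, ← pow_mul, mul_comm]
      rw [h4, zero_smul]
  rw [Finset.sum_congr rfl h1, Finset.sum_ite_eq' , if_pos (by simpa using Nat.pos_of_ne_zero hr),
    smul_smul, inv_mul_cancel₀ hrk, one_smul]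

end Modules

/-! ### Uniserial modules, and why bricks are uniserial. -/

section Generators

variable {k : Type u} [Field k] {r : ℕ} {ξ : k}

open TAlgebra

set_option linter.unusedSectionVars false

variable {M N : Type*} [AddCommGroup M] [Module k M] [Module (TAlgebra k r ξ) M]
  [IsScalarTower k (TAlgebra k r ξ) M] [AddCommGroup N] [Module k N] [Module (TAlgebra k r ξ) N]
  [IsScalarTower k (TAlgebra k r ξ) N]

lemma pow_eq_one_of_g_smul {v : M} {μ : k} (hv : g k r ξ • v = μ • v) (hv0 : v ≠ 0) :
    μ ^ r = 1 := by
  have h := g_pow_smul hv r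
  rw [g_pow, one_smul] at h
  have h1 : (μ ^ r - 1) • v = 0 := by rw [sub_smul, ← h, one_smul, sub_self]
  exact sub_eq_zero.1 ((smul_eq_zero.1 h1).resolve_right hv0)

lemma g_smul_x_pow_smul' (m : M) (i : ℕ) :
    g k r ξ • x k r ξ ^ i • m = ξ ^ i • x k r ξ ^ i • g k r ξ • m := by
  induction i with
  | zero => simp
  | succ i ih =>
    rw [pow_succ', mul_smul, g_smul_x_smul, ih, smul_comm_scalar]
    simp only [pow_succ', mul_smul]

lemma eigenProj_smul_g_smul (hr : r ≠ 0) {μ : k} (hμ : μ ^ r = 1) (m : M) :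
    eigenProj r ξ μ • g k r ξ • m = μ • eigenProj r ξ μ • m := by
  rw [← g_smul_eigenProj_smul hr hμ, ← mul_smul, ← mul_smul]
  congr 1
  simp only [eigenProj, smul_mul_assoc, mul_smul_comm, Finset.sum_mul, Finset.mul_sum, ← pow_succ,
    ← pow_succ']

/-- For `i < l ≤ r` the weights `ξ ^ i * μ` are distinct, so the projector onto one of them isolates
a single term. -/
lemma eq_zero_of_sum_smul_x_pow_smul_eq_zero (hξ : IsPrimitiveRoot ξ r) (hr : r ≠ 0) {v : M} {μ : k}
    (hv : g k r ξ • v = μ • v) {l : ℕ} (hl : l ≤ r) (hne : ∀ i < l, x k r ξ ^ i • v ≠ 0)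
    {c : ℕ → k} (hc : ∑ i ∈ Finset.range l, c i • x k r ξ ^ i • v = 0) {i : ℕ} (hi : i < l) :
    c i = 0 := by
  have : NeZero r := ⟨hr⟩
  have hrk : (r : k) ≠ 0 := hξ.neZero'.out
  have hv0 : v ≠ 0 := by simpa using hne 0 (by lia)
  have hμ := pow_eq_one_of_g_smul hv hv0
  have hμ0 : μ ≠ 0 := by rintro rfl; simp [hr] at hμ
  have hp (j : ℕ) : (ξ ^ j * μ) ^ r = 1 := by
    rw [mul_pow, hμ, pow_right_comm, hξ.pow_eq_one, one_pow, one_mul]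
  have h1 := congrArg (eigenProj r ξ (ξ ^ i * μ) • ·) hc
  simp only [Finset.smul_sum, smul_zero] at h1
  rw [Finset.sum_eq_single_of_mem i (by simpa using hi), smul_comm_scalar,
    eigenProj_smul_self hrk (by simp [hμ0, hξ.ne_zero hr]) (g_smul_x_pow_smul hv i)] at h1
  · exact (smul_eq_zero.1 h1).resolve_right (hne i hi)
  · intro j hj hji
    rw [smul_comm_scalar, eigenProj_smul_of_ne (hp i) (hp j) _ (g_smul_x_pow_smul hv j), smul_zero]
    intro h2
    exact hji (hξ.pow_inj (by simp at hj; lia) (by lia) (mul_right_cancel₀ hμ0 h2))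

variable (r ξ) in
/-- `M` is the uniserial module of length `l` generated by the `μ`-eigenvector `v` of `g`. -/
structure IsGenerator (v : M) (μ : k) (l : ℕ) : Prop where
  g_smul : g k r ξ • v = μ • v
  x_pow_smul : x k r ξ ^ l • v = 0
  x_pow_smul_ne : ∀ i < l, x k r ξ ^ i • v ≠ 0
  exists_smul_eq : ∀ m : M, ∃ t : TAlgebra k r ξ, t • v = m

/-- A homogeneous element of a uniserial module of length at most `r` is a multiple of some
`x ^ t • v`. -/
lemma IsGenerator.exists_eq_smul (hξ : IsPrimitiveRoot ξ r) (hr : r ≠ 0) {v : M} {μ : k} {l : ℕ}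
    (h : IsGenerator r ξ v μ l) (hl : l ≤ r) {y : M} {ν : k} (hy : g k r ξ • y = ν • y)
    (hy0 : y ≠ 0) : ∃ t < l, ∃ c : k, c ≠ 0 ∧ ν = ξ ^ t * μ ∧ y = c • x k r ξ ^ t • v := by
  obtain ⟨s, rfl⟩ := h.exists_smul_eq y
  obtain ⟨c, hc⟩ := exists_smul_eq_sum h.g_smul h.x_pow_smul s
  have hcoef : ∀ i < l, c i * (ξ ^ i * μ - ν) = 0 := by
    intro i hi
    refine eq_zero_of_sum_smul_x_pow_smul_eq_zero (c := fun i => c i * (ξ ^ i * μ - ν)) hξ hr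
      h.g_smul hl h.x_pow_smul_ne ?_ hi
    have h1 : g k r ξ • s • v - ν • s • v = 0 := by rw [hy, sub_self]
    rw [hc, Finset.smul_sum, Finset.smul_sum, ← Finset.sum_sub_distrib] at h1
    rw [← h1]
    refine Finset.sum_congr rfl fun j _ => ?_
    rw [smul_comm_scalar, g_smul_x_pow_smul h.g_smul, smul_smul, smul_smul, ← sub_smul]
    ring_nf
  obtain ⟨t, ht, hct⟩ : ∃ t < l, c t ≠ 0 := by
    by_contra! H
    exact hy0 (hc.trans (Finset.sum_eq_zero fun i hi => by
      rw [H i (by simpa using hi), zero_smul]))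
  have hν : ν = ξ ^ t * μ := (sub_eq_zero.1 ((mul_eq_zero.1 (hcoef t ht)).resolve_left hct)).symm
  have hv0 : v ≠ 0 := by rintro rfl; simp at hy0
  have hμ := pow_eq_one_of_g_smul h.g_smul hv0
  have hμ0 : μ ≠ 0 := by rintro rfl; simp [hr] at hμ
  refine ⟨t, ht, c t, hct, hν, hc.trans (Finset.sum_eq_single_of_mem t (by simpa using ht) ?_)⟩
  intro j hj hjt
  have hj' : j < l := by simpa using hj
  rcases mul_eq_zero.1 (hcoef j hj') with h0 | h0
  · rw [h0, zero_smul]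
  · rw [hν] at h0
    exact absurd (hξ.pow_inj (by lia) (by lia) (mul_right_cancel₀ hμ0 (sub_eq_zero.1 h0))) hjt

lemma IsGenerator.exists_linearMap (hξ : IsPrimitiveRoot ξ r) (hr : r ≠ 0) {v : M} {μ : k} {l : ℕ}
    (h : IsGenerator r ξ v μ l) (hl : l ≤ r) {y : N} (hy : g k r ξ • y = μ • y)
    (hy' : x k r ξ ^ l • y = 0) : ∃ f : M →ₗ[TAlgebra k r ξ] N, f v = y := by
  have hker : LinearMap.ker (LinearMap.toSpanSingleton (TAlgebra k r ξ) M v) ≤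
      LinearMap.ker (LinearMap.toSpanSingleton (TAlgebra k r ξ) N y) := by
    intro t ht
    simp only [LinearMap.mem_ker, LinearMap.toSpanSingleton_apply] at ht ⊢
    -- Expanding in the product `M × N` gives `t • v` and `t • y` the same coefficients.
    obtain ⟨c, hc⟩ := exists_smul_eq_sum (v := (v, y)) (μ := μ) (l := l)
      (by rw [Prod.smul_mk, Prod.smul_mk, h.g_smul, hy])
      (by rw [Prod.smul_mk, h.x_pow_smul, hy', Prod.mk_zero_zero]) t
    have h1 := congrArg Prod.fst hc
    have h2 := congrArg Prod.snd hc
    simp only [Prod.fst_sum, Prod.snd_sum, Prod.smul_fst, Prod.smul_snd] at h1 h2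
    rw [h2]
    refine Finset.sum_eq_zero fun i hi => ?_
    rw [eq_zero_of_sum_smul_x_pow_smul_eq_zero hξ hr h.g_smul hl h.x_pow_smul_ne (h1.symm.trans ht)
      (by simpa using hi), zero_smul]
  have hsurj : Function.Surjective (LinearMap.toSpanSingleton (TAlgebra k r ξ) M v) :=
    h.exists_smul_eq
  refine ⟨(Submodule.liftQ _ _ hker).comp
    (LinearMap.quotKerEquivOfSurjective _ hsurj).symm.toLinearMap, ?_⟩
  have h1 : (LinearMap.quotKerEquivOfSurjective _ hsurj).symm v = Submodule.Quotient.mk 1 := by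
    rw [LinearEquiv.symm_apply_eq]
    exact (one_smul (TAlgebra k r ξ) v).symm
  simp only [LinearMap.comp_apply, LinearEquiv.coe_coe, h1]
  exact one_smul (TAlgebra k r ξ) y

/-- Multiplication by the central element `x ^ r`. -/
def xPowMap (hξ : ξ ^ r = 1) : M →ₗ[TAlgebra k r ξ] M :=
  linearMapOfGen (k := k)
    { toFun := fun m => x k r ξ ^ r • m
      map_add' := smul_add _
      map_smul' := fun c m => smul_comm_scalar r ξ _ c m }
    (fun m => by simp [g_smul_x_pow_smul', hξ])
    (fun m => by simp [← mul_smul, ← pow_succ, ← pow_succ'])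

/-- Let `x ^ l` be the highest power of `x` not killing `M`, and `v` an eigenvector with `x ^ l • v
≠ 0`. A functional detecting `x ^ l • v` yields an endomorphism `p` with values in the submodule
generated by `v` and `p v` not killed by `x ^ l`. As `p` is a nonzero scalar, `v` generates `M`. -/
lemma exists_isGenerator [Nontrivial M] (hξ : IsPrimitiveRoot ξ r) (hr : r ≠ 0)
    (hnil : ∃ n : ℕ, ∀ m : M, x k r ξ ^ n • m = 0)
    (hend : ∀ f : M →ₗ[TAlgebra k r ξ] M, ∃ c : k, ∀ m, f m = c • m) :
    ∃ (v : M) (μ : k) (l : ℕ), l ≤ r ∧ IsGenerator r ξ v μ l := by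
  have hξ0 : ξ ≠ 0 := hξ.ne_zero hr
  have : NeZero r := ⟨hr⟩
  have hrk : (r : k) ≠ 0 := hξ.neZero'.out
  have hxr : ∀ m : M, x k r ξ ^ r • m = 0 := by
    obtain ⟨c, hc⟩ := hend (xPowMap hξ.pow_eq_one)
    replace hc : ∀ m : M, x k r ξ ^ r • m = c • m := hc
    obtain ⟨n, hn⟩ := hnil
    have h1 : ∀ j : ℕ, ∀ m : M, x k r ξ ^ (r * j) • m = c ^ j • m := by
      intro j
      induction j with
      | zero => simp
      | succ j ih => intro m; rw [mul_add, mul_one, pow_add, mul_smul, hc, ih, smul_smul, pow_succ]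
    obtain ⟨m, hm⟩ := exists_ne (0 : M)
    have h2 : c ^ n • m = 0 := by
      have h3 : r * n = (r - 1) * n + n := by
        rw [← Nat.succ_mul, Nat.succ_eq_add_one, Nat.sub_add_cancel (Nat.one_le_iff_ne_zero.2 hr)]
      rw [← h1, h3, pow_add, mul_smul, hn, smul_zero]
    have h3 : c = 0 := eq_zero_of_pow_eq_zero ((smul_eq_zero.1 h2).resolve_right hm)
    intro m
    rw [hc, h3, zero_smul]
  classical
  have hex : ∃ l : ℕ, ∀ m : M, x k r ξ ^ l • m = 0 := ⟨r, hxr⟩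
  have hlr : Nat.find hex ≤ r := Nat.find_min' hex hxr
  have hl : ∀ m : M, x k r ξ ^ Nat.find hex • m = 0 := Nat.find_spec hex
  have hmin := fun j => Nat.find_min (m := j) hex
  generalize Nat.find hex = l at hlr hl hmin
  obtain ⟨l, rfl⟩ : ∃ l', l = l' + 1 := Nat.exists_eq_succ_of_ne_zero (by
    rintro rfl
    obtain ⟨m, hm⟩ := exists_ne (0 : M)
    exact hm (by simpa using hl m))
  obtain ⟨m₀, hm₀⟩ : ∃ m : M, x k r ξ ^ l • m ≠ 0 := by simpa using hmin l (by lia)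
  obtain ⟨μ, hμ, hvl⟩ : ∃ μ : k, μ ^ r = 1 ∧ x k r ξ ^ l • eigenProj r ξ μ • m₀ ≠ 0 := by
    by_contra! H
    apply hm₀
    rw [← one_smul (TAlgebra k r ξ) m₀, ← sum_eigenProj hξ hr, Finset.sum_smul, Finset.smul_sum]
    exact Finset.sum_eq_zero fun c _ => H _ (by rw [pow_right_comm, hξ.pow_eq_one, one_pow])
  have hv := g_smul_eigenProj_smul (ξ := ξ) hr hμ m₀
  generalize eigenProj r ξ μ • m₀ = v at hvl hv
  have hμ0 : μ ≠ 0 := by rintro rfl; simp [hr] at hμ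
  set ν := ξ ^ l * μ with hν
  have hνr : ν ^ r = 1 := by rw [hν, mul_pow, hμ, pow_right_comm, hξ.pow_eq_one, one_pow, one_mul]
  have hν0 : ν ≠ 0 := by simp [hν, hξ0, hμ0]
  obtain ⟨φ₀, hφ₀⟩ : ∃ φ : Module.Dual k M, φ (x k r ξ ^ l • v) ≠ 0 := by
    by_contra! H
    exact hvl ((Module.forall_dual_apply_eq_zero_iff k _).1 H)
  -- Precomposing with the projector makes `φ` vanish off weight `ν`; this is what makes `p` commute
  -- with `g`.
  let φ : M →ₗ[k] k :=
    { toFun := fun m => φ₀ (eigenProj r ξ ν • m)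
      map_add' := fun a b => by rw [smul_add, map_add]
      map_smul' := fun c a => by rw [smul_comm_scalar, map_smul, RingHom.id_apply] }
  have hφg (m : M) : φ (g k r ξ • m) = ν * φ m := by
    change φ₀ _ = ν * φ₀ _
    rw [eigenProj_smul_g_smul hr hνr, map_smul, smul_eq_mul]
  have hφ : φ (x k r ξ ^ l • v) ≠ 0 := by
    change φ₀ _ ≠ 0
    rwa [eigenProj_smul_self hrk hν0 (g_smul_x_pow_smul hv l)]
  have hφx (s : ℕ) (hs : s ≤ l) (m : M) :
      φ (x k r ξ ^ (l - s) • g k r ξ • m) = ξ ^ s * μ * φ (x k r ξ ^ (l - s) • m) := by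
    have h1 := hφg (x k r ξ ^ (l - s) • m)
    rw [g_smul_x_pow_smul', map_smul, smul_eq_mul, hν] at h1
    apply mul_left_cancel₀ (pow_ne_zero (l - s) hξ0)
    rw [h1, ← Nat.sub_add_cancel hs, pow_add, Nat.sub_add_cancel hs]
    ring
  let p₀ : M →ₗ[k] M :=
    { toFun := fun m => ∑ s ∈ Finset.range (l + 1), φ (x k r ξ ^ (l - s) • m) • x k r ξ ^ s • v
      map_add' := fun a b => by simp only [smul_add, map_add, add_smul, Finset.sum_add_distrib]
      map_smul' := fun c a => by
        simp only [smul_comm_scalar, map_smul, RingHom.id_apply, Finset.smul_sum, smul_smul,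
          smul_eq_mul] }
  let p : M →ₗ[TAlgebra k r ξ] M := linearMapOfGen p₀
    (fun m => by
      simp only [p₀, LinearMap.coe_mk, AddHom.coe_mk, Finset.smul_sum]
      refine Finset.sum_congr rfl fun s hs => ?_
      rw [hφx s (by simp at hs; lia), smul_comm_scalar, g_smul_x_pow_smul hv, smul_smul]
      ring_nf)
    (fun m => by
      simp only [p₀, LinearMap.coe_mk, AddHom.coe_mk, Finset.smul_sum]
      -- The two sums agree after a shift of index; the leftover end terms contain `x ^ (l + 1) • m`
      -- and `x ^ (l + 1) • v`, both zero.
      rw [Finset.sum_range_succ', Finset.sum_range_succ]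
      congr 1
      · refine Finset.sum_congr rfl fun s hs => ?_
        have hs' : s < l := by simpa using hs
        rw [smul_comm_scalar, ← mul_smul, ← mul_smul, ← pow_succ, ← pow_succ',
          show l - (s + 1) + 1 = l - s by lia]
      · rw [smul_comm_scalar, ← mul_smul, ← mul_smul, ← pow_succ, ← pow_succ', hl v, Nat.sub_zero,
          hl m, map_zero, zero_smul, smul_zero])
  have hp (m : M) : p m = ∑ s ∈ Finset.range (l + 1),
    φ (x k r ξ ^ (l - s) • m) • x k r ξ ^ s • v := rfl
  obtain ⟨c, hc⟩ := hend p
  have hc0 : c ≠ 0 := by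
    rintro rfl
    have h1 : x k r ξ ^ l • p v = 0 := by rw [hc, zero_smul, smul_zero]
    -- Applying `x ^ l` to `p v` leaves only the `s = 0` term, `φ (x ^ l • v) • x ^ l • v`, which is
    -- nonzero.
    rw [hp, Finset.smul_sum, Finset.sum_eq_single_of_mem 0 (by simp), smul_comm_scalar] at h1
    · simp [hφ, hvl] at h1
    · intro s _ hs
      obtain ⟨s, rfl⟩ := Nat.exists_eq_succ_of_ne_zero hs
      rw [smul_comm_scalar, ← mul_smul, ← pow_add, show l + s.succ = s + (l + 1) by lia, pow_add,
        mul_smul, hl, smul_zero, smul_zero]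
  refine ⟨v, μ, l + 1, hlr, hv, hl v, fun i hi h0 => hvl ?_, fun m => ?_⟩
  · rw [show l = l - i + i by lia, pow_add, mul_smul, h0, smul_zero]
  · refine ⟨c⁻¹ • ∑ s ∈ Finset.range (l + 1), φ (x k r ξ ^ (l - s) • m) • x k r ξ ^ s, ?_⟩
    rw [smul_assoc, Finset.sum_smul]
    simp only [smul_assoc]
    rw [← hp, hc, smul_smul, inv_mul_cancel₀ hc0, one_smul]

end Generators

/-! ### Cyclic modules and their polynomial model. -/

section Cyclic

variable {k : Type u} [Field k] {r : ℕ} {ξ : k}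

open TAlgebra

variable (r ξ) in
/-- The left ideal generated by `g - μ` and `x ^ N`. -/
def cyclicIdeal (μ : k) (N : ℕ) : Submodule (TAlgebra k r ξ) (TAlgebra k r ξ) :=
  Submodule.span _ {g k r ξ - algebraMap k _ μ, x k r ξ ^ N}

variable (r ξ) in
/-- The module `T_r / (T_r (g - μ) + T_r x ^ N)`. -/
abbrev CyclicModule (μ : k) (N : ℕ) : Type u :=
  TAlgebra k r ξ ⧸ cyclicIdeal r ξ μ N

variable (r ξ) in
/-- The generator of `CyclicModule r ξ μ N`. -/
def cyclicGen (μ : k) (N : ℕ) : CyclicModule r ξ μ N := Submodule.Quotient.mk 1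

lemma smul_cyclicGen (μ : k) (N : ℕ) (t : TAlgebra k r ξ) :
    t • cyclicGen r ξ μ N = Submodule.Quotient.mk t := by
  rw [cyclicGen, ← Submodule.Quotient.mk_smul, smul_eq_mul, mul_one]

lemma g_smul_cyclicGen (μ : k) (N : ℕ) :
    g k r ξ • cyclicGen r ξ μ N = algebraMap k (TAlgebra k r ξ) μ • cyclicGen r ξ μ N := by
  rw [smul_cyclicGen, smul_cyclicGen, Submodule.Quotient.eq]
  exact Submodule.subset_span (by simp)

lemma x_pow_smul_cyclicGen (μ : k) (N : ℕ) : x k r ξ ^ N • cyclicGen r ξ μ N = 0 := by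
  rw [smul_cyclicGen, Submodule.Quotient.mk_eq_zero]
  exact Submodule.subset_span (by simp)

lemma exists_smul_cyclicGen (μ : k) (N : ℕ) (m : CyclicModule r ξ μ N) :
    ∃ t : TAlgebra k r ξ, t • cyclicGen r ξ μ N = m := by
  obtain ⟨t, rfl⟩ := Submodule.Quotient.mk_surjective _ m
  exact ⟨t, smul_cyclicGen μ N t⟩

section

variable {N : Type*} [AddCommGroup N] [Module k N] [Module (TAlgebra k r ξ) N]
  [IsScalarTower k (TAlgebra k r ξ) N]

lemma exists_linearMap_cyclicModule {μ : k} {n : ℕ} {y : N} (hy : g k r ξ • y = μ • y)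
    (hy' : x k r ξ ^ n • y = 0) :
    ∃ f : CyclicModule r ξ μ n →ₗ[TAlgebra k r ξ] N, f (cyclicGen r ξ μ n) = y := by
  refine ⟨Submodule.liftQ _ (LinearMap.toSpanSingleton (TAlgebra k r ξ) N y) ?_, one_smul _ y⟩
  rw [cyclicIdeal, Submodule.span_le]
  rintro t (rfl | rfl)
  · simp [sub_smul, hy]
  · simpa using hy'

end

/-- The action of `T_r` on `k[X]`: `x` is multiplication by `X`, and `g` is `p(X) ↦ p(ξ X)`. -/
def polynomialAction (hξ : ξ ^ r = 1) : TAlgebra k r ξ →ₐ[k] Module.End k (Polynomial k) :=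
  RingQuot.liftAlgHom k ⟨FreeAlgebra.lift k fun y => match y with
    | .g => (Polynomial.aeval (Polynomial.C ξ * Polynomial.X)).toLinearMap
    | .x => LinearMap.mulLeft k Polynomial.X, by
    rintro _ _ (_ | _)
    · simp only [map_pow, FreeAlgebra.lift_ι_apply, map_one]
      have h1 (j : ℕ) : (Polynomial.aeval (Polynomial.C ξ * Polynomial.X)).toLinearMap ^ j =
          (Polynomial.aeval (R := k) (Polynomial.C (ξ ^ j) * Polynomial.X)).toLinearMap := by
        induction j with
        | zero => ext; simp
        | succ j ih =>
          rw [pow_succ, ih]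
          refine LinearMap.ext fun p => ?_
          simp only [Module.End.mul_apply, AlgHom.toLinearMap_apply]
          rw [← AlgHom.comp_apply]
          congr 1
          refine Polynomial.algHom_ext ?_
          simp only [AlgHom.comp_apply, Polynomial.aeval_X, map_mul, Polynomial.aeval_C,
            Polynomial.algebraMap_eq, pow_succ]
          ring
      rw [h1, hξ]
      ext
      simp
    · simp only [map_mul, map_smul, FreeAlgebra.lift_ι_apply]
      refine LinearMap.ext fun p => ?_
      simp [Polynomial.smul_eq_C_mul, mul_assoc]⟩

lemma polynomialAction_g (hξ : ξ ^ r = 1) (p : Polynomial k) :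
    polynomialAction hξ (g k r ξ) p = Polynomial.aeval (Polynomial.C ξ * Polynomial.X) p := by
  simp [polynomialAction, g]

lemma polynomialAction_x (hξ : ξ ^ r = 1) (p : Polynomial k) :
    polynomialAction hξ (x k r ξ) p = Polynomial.X * p := by
  simp [polynomialAction, x]

lemma X_pow_dvd_polynomialAction (hξ : ξ ^ r = 1) (N : ℕ) (t : TAlgebra k r ξ) :
    ∀ p : Polynomial k, Polynomial.X ^ N ∣ p → Polynomial.X ^ N ∣ polynomialAction hξ t p := by
  induction t using TAlgebra.induction with
  | hk c =>
    intro p hp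
    rw [AlgHom.commutes, Module.algebraMap_end_apply, Polynomial.smul_eq_C_mul]
    exact hp.mul_left _
  | hg =>
    rintro _ ⟨q, rfl⟩
    rw [polynomialAction_g, map_mul, map_pow, Polynomial.aeval_X, mul_pow]
    exact ((dvd_mul_left _ _).mul_right _)
  | hx => intro p hp; rw [polynomialAction_x]; exact hp.mul_left _
  | hmul a b ha hb => intro p hp; rw [map_mul]; exact ha _ (hb _ hp)
  | hadd a b ha hb => intro p hp; rw [map_add]; exact dvd_add (ha _ hp) (hb _ hp)

lemma polynomialAction_x_pow (hξ : ξ ^ r = 1) (i : ℕ) :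
    polynomialAction hξ (x k r ξ ^ i) 1 = Polynomial.X ^ i := by
  induction i with
  | zero => simp
  | succ i ih =>
    rw [pow_succ', map_mul, Module.End.mul_apply, ih, polynomialAction_x, pow_succ']

/-- In the action on `k[X]`, `g - 1` kills the polynomial `1` and the multiples of `X ^ N` form a
submodule. So every element of the ideal sends `1` to a multiple of `X ^ N`, whereas `x ^ i` sends
it to `X ^ i`. -/
lemma x_pow_smul_cyclicGen_ne_zero (hξ : ξ ^ r = 1) {N i : ℕ} (hi : i < N) :
    x k r ξ ^ i • cyclicGen r ξ 1 N ≠ 0 := by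
  rw [smul_cyclicGen, Ne, Submodule.Quotient.mk_eq_zero]
  intro h
  have key : ∀ t ∈ cyclicIdeal r ξ 1 N, Polynomial.X ^ N ∣ polynomialAction hξ t 1 := by
    intro t ht
    induction ht using Submodule.span_induction with
    | mem t ht =>
      rcases ht with rfl | rfl
      · simp [polynomialAction_g]
      · rw [polynomialAction_x_pow]
    | zero => simp
    | add a b _ _ ha hb => rw [map_add]; exact dvd_add ha hb
    | smul c a _ ha =>
      rw [smul_eq_mul, map_mul]; exact X_pow_dvd_polynomialAction hξ N c _ ha
  have h1 := key _ h
  rw [polynomialAction_x_pow, pow_dvd_pow_iff Polynomial.X_ne_zero Polynomial.not_isUnit_X] at h1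
  lia

end Cyclic

/-! ### Passing between modules and the category `FinDimXNilpotent`. -/

section Category

variable {k : Type u} [Field k] {r : ℕ} {ξ : k}

open TAlgebra Abelian
open scoped ModuleCat

instance : (isFinDimXNilpotent k r ξ).ι.PreservesHomology where
  preservesKernels _ _ f := (isFinDimXNilpotent k r ξ).preservesKernels_ι f
  preservesCokernels _ _ f := (isFinDimXNilpotent k r ξ).preservesCokernels_ι f

/-- The morphism of `FinDimXNilpotent` given by a linear map. -/
def mkHom {X Y : FinDimXNilpotent k r ξ} (f : X.obj →ₗ[TAlgebra k r ξ] Y.obj) : X ⟶ Y :=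
  ObjectProperty.homMk (ModuleCat.ofHom f)

@[simp] lemma mkHom_apply {X Y : FinDimXNilpotent k r ξ} (f : X.obj →ₗ[TAlgebra k r ξ] Y.obj)
    (m : X.obj) : (mkHom f).hom.hom m = f m := rfl

lemma finDimXNilpotent_hom_ext {X Y : FinDimXNilpotent k r ξ} {f g : X ⟶ Y}
    (h : ∀ m : X.obj, f.hom.hom m = g.hom.hom m) : f = g := by
  ext m
  exact h m

lemma smul_hom_apply {X Y : FinDimXNilpotent k r ξ} (c : k) (f : X ⟶ Y) (m : X.obj) :
    (c • f).hom.hom m = c • f.hom.hom m := by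
  rfl

lemma surjective_of_epi {X Y : FinDimXNilpotent k r ξ} (f : X ⟶ Y) [Epi f] :
    Function.Surjective f.hom.hom := by
  have := (isFinDimXNilpotent k r ξ).preservesEpimorphisms_ι_of_isNormalMonoCategory
  exact (ModuleCat.epi_iff_surjective _).1 (inferInstanceAs (Epi ((isFinDimXNilpotent k r ξ).ι.map f)))

lemma shortExact_of_exact {X Y Z : FinDimXNilpotent k r ξ} (f : X ⟶ Y) (g : Y ⟶ Z)
    (hf : Function.Injective f.hom.hom) (hg : Function.Surjective g.hom.hom)
    (hfg : Function.Exact f.hom.hom g.hom.hom) :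
    ∃ w : f ≫ g = 0, (ShortComplex.mk f g w).ShortExact := by
  have w : f ≫ g = 0 := finDimXNilpotent_hom_ext fun m => hfg.apply_apply_eq_zero m
  refine ⟨w, ?_⟩
  have h1 : ((ShortComplex.mk f g w).map (isFinDimXNilpotent k r ξ).ι).Exact :=
    (ShortComplex.ShortExact.moduleCat_exact_iff_function_exact _).2 hfg
  have h2 : Mono f := (isFinDimXNilpotent k r ξ).ι.mono_of_mono_map
    ((ModuleCat.mono_iff_injective _).2 hf)
  have h3 : Epi g := (isFinDimXNilpotent k r ξ).ι.epi_of_epi_map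
    ((ModuleCat.epi_iff_surjective _).2 hg)
  exact { exact := (ShortComplex.exact_map_iff_of_faithful _ _).1 h1 }

lemma isFinDimXNilpotent_of_generator {M : ModuleCat.{u} (TAlgebra k r ξ)} {p : M} {μ : k} {N : ℕ}
    (hp : g k r ξ • p = μ • p) (hp' : x k r ξ ^ N • p = 0)
    (hM : ∀ m : M, ∃ t : TAlgebra k r ξ, t • p = m) : isFinDimXNilpotent k r ξ M := by
  have key (m : M) : ∃ c : ℕ → k, m = ∑ i ∈ Finset.range N, c i • x k r ξ ^ i • p := by
    obtain ⟨t, rfl⟩ := hM m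
    exact exists_smul_eq_sum hp hp' t
  have hn (m : M) : x k r ξ ^ N • m = 0 := by
    obtain ⟨c, hc⟩ := key m
    rw [hc, Finset.smul_sum]
    refine Finset.sum_eq_zero fun i _ => ?_
    rw [smul_comm_scalar, ← mul_smul, ← pow_add, add_comm, pow_add, mul_smul, hp', smul_zero,
      smul_zero]
  classical
  refine ⟨⟨(Finset.range N).image fun i => x k r ξ ^ i • p, ?_⟩, N, hn⟩
  rw [eq_top_iff]
  rintro m -
  obtain ⟨c, rfl⟩ := key m
  refine Submodule.sum_mem _ fun i hi => Submodule.smul_mem _ _ (Submodule.subset_span ?_)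
  exact Finset.mem_coe.2 (Finset.mem_image_of_mem _ hi)

variable (r ξ) in
/-- `CyclicModule r ξ μ N` as an object of `FinDimXNilpotent`. -/
def cyclicObj (μ : k) (N : ℕ) : FinDimXNilpotent k r ξ :=
  ⟨ModuleCat.of _ (CyclicModule r ξ μ N),
    isFinDimXNilpotent_of_generator (p := cyclicGen r ξ μ N) (g_smul_cyclicGen μ N)
      (x_pow_smul_cyclicGen μ N) (exists_smul_cyclicGen μ N)⟩

variable (r ξ) in
/-- The generator of `cyclicObj`. -/
def cyclicObjGen (μ : k) (N : ℕ) : (cyclicObj r ξ μ N).obj := cyclicGen r ξ μ N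

lemma g_smul_cyclicObjGen (μ : k) (N : ℕ) :
    g k r ξ • cyclicObjGen r ξ μ N = μ • cyclicObjGen r ξ μ N := g_smul_cyclicGen μ N

lemma x_pow_smul_cyclicObjGen (μ : k) (N : ℕ) : x k r ξ ^ N • cyclicObjGen r ξ μ N = 0 :=
  x_pow_smul_cyclicGen μ N

lemma exists_smul_cyclicObjGen (μ : k) (N : ℕ) (m : (cyclicObj r ξ μ N).obj) :
    ∃ t : TAlgebra k r ξ, t • cyclicObjGen r ξ μ N = m := exists_smul_cyclicGen μ N m

lemma exists_hom_cyclicObj {Y : FinDimXNilpotent k r ξ} {μ : k} {N : ℕ} {y : Y.obj}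
    (hy : g k r ξ • y = μ • y) (hy' : x k r ξ ^ N • y = 0) :
    ∃ f : cyclicObj r ξ μ N ⟶ Y, f.hom.hom (cyclicObjGen r ξ μ N) = y := by
  obtain ⟨f, hf⟩ := exists_linearMap_cyclicModule hy hy'
  exact ⟨mkHom (X := cyclicObj r ξ μ N) f, hf⟩

lemma exists_isGenerator_of_isBrick (hξ : IsPrimitiveRoot ξ r) (hr : r ≠ 0)
    {X : FinDimXNilpotent k r ξ} (hX : IsBrick k X) :
    ∃ (v : X.obj) (μ : k) (l : ℕ), l ≤ r ∧ IsGenerator r ξ v μ l := by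
  have : Nontrivial X.obj := by
    by_contra H
    rw [not_nontrivial_iff_subsingleton] at H
    have := hX.1 (a₁ := 0) (a₂ := 1) (finDimXNilpotent_hom_ext fun m => Subsingleton.elim _ _)
    exact zero_ne_one this
  refine exists_isGenerator hξ hr X.property.2 fun f => ?_
  obtain ⟨c, hc⟩ := hX.2 (mkHom f)
  exact ⟨c, fun m => by rw [← mkHom_apply f, ← hc]; rfl⟩

end Category

/-! ### `Ext¹` between uniserial bricks. -/

section ExtComputation

variable {k : Type u} [Field k] {r : ℕ} {ξ : k}

open TAlgebra Abelian
open scoped ModuleCat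

lemma ext_of_generator {X Y : FinDimXNilpotent k r ξ} {f g : X ⟶ Y} {u : X.obj}
    (hu : ∀ m : X.obj, ∃ t : TAlgebra k r ξ, t • u = m) (h : f.hom.hom u = g.hom.hom u) :
    f = g := by
  refine finDimXNilpotent_hom_ext fun m => ?_
  obtain ⟨t, rfl⟩ := hu m
  rw [map_smul, map_smul, h]

lemma IsGenerator.x_pow_smul_eq_zero {X : FinDimXNilpotent k r ξ} {v : X.obj} {μ : k} {l : ℕ}
    (h : IsGenerator r ξ v μ l) (m : X.obj) : x k r ξ ^ l • m = 0 := by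
  obtain ⟨t, rfl⟩ := h.exists_smul_eq m
  obtain ⟨c, hc⟩ := exists_smul_eq_sum h.g_smul h.x_pow_smul t
  rw [hc, Finset.smul_sum]
  refine Finset.sum_eq_zero fun i _ => ?_
  rw [smul_comm_scalar, ← mul_smul, ← pow_add, add_comm, pow_add, mul_smul, h.x_pow_smul, smul_zero,
    smul_zero]

/-- The kernel of the projection from a longer uniserial module is generated by `x ^ l • p`. -/
lemma exists_smul_x_pow_smul_eq (hξ : IsPrimitiveRoot ξ r) (hr : r ≠ 0)
    {X : FinDimXNilpotent k r ξ} {v : X.obj} {μ : k} {l : ℕ} (h : IsGenerator r ξ v μ l)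
    (hl : l ≤ r) {N : ℕ} (hN : l ≤ N) {π : cyclicObj r ξ μ N ⟶ X}
    (hπ : π.hom.hom (cyclicObjGen r ξ μ N) = v) {m : (cyclicObj r ξ μ N).obj}
    (hm : π.hom.hom m = 0) :
    ∃ s : TAlgebra k r ξ, m = s • x k r ξ ^ l • cyclicObjGen r ξ μ N := by
  obtain ⟨t, rfl⟩ := exists_smul_cyclicObjGen μ N m
  obtain ⟨c, hc⟩ := exists_smul_eq_sum (g_smul_cyclicObjGen μ N) (x_pow_smul_cyclicObjGen μ N) t
  obtain ⟨n, rfl⟩ := Nat.exists_eq_add_of_le hN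
  have hπk (a : k) (y) : π.hom.hom (a • y) = a • π.hom.hom y :=
    (π.hom.hom.restrictScalars k).map_smul a y
  have h1 : ∑ i ∈ Finset.range l, c i • x k r ξ ^ i • v = 0 := by
    rw [hc, map_sum, Finset.sum_range_add] at hm
    simp only [hπk, map_smul, hπ] at hm
    rw [← hm, left_eq_add]
    refine Finset.sum_eq_zero fun i _ => ?_
    rw [add_comm, pow_add, mul_smul, h.x_pow_smul, smul_zero, smul_zero]
  have h2 (i : ℕ) (hi : i < l) : c i = 0 :=
    eq_zero_of_sum_smul_x_pow_smul_eq_zero hξ hr h.g_smul hl h.x_pow_smul_ne h1 hi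
  refine ⟨∑ i ∈ Finset.range n, c (l + i) • x k r ξ ^ i, ?_⟩
  rw [hc, Finset.sum_range_add, Finset.sum_smul, Finset.sum_eq_zero, zero_add]
  · refine Finset.sum_congr rfl fun i _ => ?_
    rw [smul_assoc, ← mul_smul, ← pow_add, add_comm i]
  · intro i hi
    rw [h2 i (by simpa using hi), zero_smul]

/-- These covers play the role of projective covers: no single one kills all of `Ext¹`, but any
given class dies once `N` is large. -/
lemma exists_shortExact (hξ : IsPrimitiveRoot ξ r) (hr : r ≠ 0)
    {X : FinDimXNilpotent k r ξ} {v : X.obj} {μ : k} {l : ℕ} (h : IsGenerator r ξ v μ l)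
    (hl : l ≤ r) {N : ℕ} (hN : l ≤ N) :
    ∃ (K : FinDimXNilpotent k r ξ) (i : K ⟶ cyclicObj r ξ μ N) (π : cyclicObj r ξ μ N ⟶ X)
      (w : i ≫ π = 0) (_ : (ShortComplex.mk i π w).ShortExact) (u : K.obj),
      π.hom.hom (cyclicObjGen r ξ μ N) = v ∧
      i.hom.hom u = x k r ξ ^ l • cyclicObjGen r ξ μ N ∧
      ∀ m : K.obj, ∃ t : TAlgebra k r ξ, t • u = m := by
  obtain ⟨π, hπ⟩ := exists_hom_cyclicObj (N := N) h.g_smul (by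
    rw [← Nat.sub_add_cancel hN, pow_add, mul_smul, h.x_pow_smul, smul_zero])
  let K : FinDimXNilpotent k r ξ := ⟨ModuleCat.of _ (LinearMap.ker π.hom.hom),
    isFinDimXNilpotent_of_injective (ModuleCat.ofHom (LinearMap.ker π.hom.hom).subtype)
      Subtype.val_injective (cyclicObj r ξ μ N).property⟩
  let i : K ⟶ cyclicObj r ξ μ N := mkHom (X := K) (LinearMap.ker π.hom.hom).subtype
  have hi : Function.Injective i.hom.hom := Subtype.val_injective
  obtain ⟨w, hS⟩ := shortExact_of_exact i π hi
    (fun m => by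
      obtain ⟨t, rfl⟩ := h.exists_smul_eq m
      exact ⟨t • cyclicObjGen r ξ μ N, by rw [map_smul, hπ]⟩)
    (LinearMap.exact_subtype_ker_map π.hom.hom)
  have hu : π.hom.hom (x k r ξ ^ l • cyclicObjGen r ξ μ N) = 0 := by
    rw [map_smul, hπ, h.x_pow_smul]
  refine ⟨K, i, π, w, hS, ⟨_, hu⟩, hπ, rfl, fun m => ?_⟩
  obtain ⟨s, hs⟩ := exists_smul_x_pow_smul_eq hξ hr h hl hN hπ (m := i.hom.hom m) m.2
  exact ⟨s, hi (by rw [hs, map_smul]; rfl)⟩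

section

variable [HasExt.{w} (FinDimXNilpotent k r ξ)]

/-- A given class in `Ext¹(X, Y)` is killed by pullback to all long enough uniserial covers. -/
lemma exists_forall_comp_eq_zero (hξ : IsPrimitiveRoot ξ r) (hr : r ≠ 0)
    {X Y : FinDimXNilpotent k r ξ} {v : X.obj} {μ : k} (hμ : μ ^ r = 1)
    (hv : g k r ξ • v = μ • v) (e : Ext X Y 1) :
    ∃ N₀ : ℕ, ∀ N, N₀ ≤ N → ∀ π : cyclicObj r ξ μ N ⟶ X,
      π.hom.hom (cyclicObjGen r ξ μ N) = v → (Ext.mk₀ π).comp e (zero_add 1) = 0 := by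
  have : NeZero r := ⟨hr⟩
  have hrk : (r : k) ≠ 0 := hξ.neZero'.out
  have hμ0 : μ ≠ 0 := by rintro rfl; simp [hr] at hμ
  obtain ⟨E, p, _, hp⟩ := exists_epi_comp_ext_eq_zero e
  obtain ⟨y, hy⟩ := surjective_of_epi p v
  obtain ⟨N₀, hN₀⟩ := E.property.2
  refine ⟨N₀, fun N hN π hπ => ?_⟩
  -- Projecting the lift of `v` to weight `μ` keeps it a lift, as `v` already has that weight; so
  -- the cover factors through `E`.
  obtain ⟨q, hq⟩ := exists_hom_cyclicObj (N := N) (y := eigenProj r ξ μ • y)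
    (g_smul_eigenProj_smul hr hμ y) (by
      rw [← Nat.sub_add_cancel hN, pow_add, mul_smul, hN₀, smul_zero])
  have h1 : π = q ≫ p := by
    refine ext_of_generator (exists_smul_cyclicObjGen μ N) ?_
    change _ = p.hom.hom (q.hom.hom _)
    rw [hπ, hq, map_smul, hy, eigenProj_smul_self hrk hμ0 hv]
  rw [h1, ← Ext.mk₀_comp_mk₀_assoc, hp, Ext.comp_zero]

/-- The connecting map is described by the value on the generator of the kernel. -/
lemma exists_eq_smul_of_extClass_comp_ne_zero (hξ : IsPrimitiveRoot ξ r) (hr : r ≠ 0)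
    {X Y : FinDimXNilpotent k r ξ} {v : X.obj} {μ : k} {l : ℕ} (hX : IsGenerator r ξ v μ l)
    (hl : l ≤ r) {y : Y.obj} {ν : k} {m : ℕ} (hY : IsGenerator r ξ y ν m) (hm : m ≤ r)
    (hYX : (∀ h : Y ⟶ X, h = 0) ∨ ν = μ) {N : ℕ} (hN : r ≤ N)
    {K : FinDimXNilpotent k r ξ} {i : K ⟶ cyclicObj r ξ μ N} {π : cyclicObj r ξ μ N ⟶ X}
    {w : i ≫ π = 0} (hS : (ShortComplex.mk i π w).ShortExact) {u : K.obj}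
    (hu : i.hom.hom u = x k r ξ ^ l • cyclicObjGen r ξ μ N)
    (huK : ∀ a : K.obj, ∃ t : TAlgebra k r ξ, t • u = a) {f : K ⟶ Y}
    (hf : hS.extClass.comp (Ext.mk₀ f) (add_zero 1) ≠ 0) :
    ν = ξ ^ l * μ ∧ 0 < m ∧ ∃ c : k, c ≠ 0 ∧ f.hom.hom u = c • y := by
  have hξ0 : ξ ≠ 0 := hξ.ne_zero hr
  -- If `f u = x ^ l • z` with `z` of weight `μ`, then `f` extends along `i` to the cover, and its
  -- image under the connecting map vanishes.
  have extend (z : Y.obj) (hz : g k r ξ • z = μ • z) (hzf : x k r ξ ^ l • z = f.hom.hom u) :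
      False := by
    obtain ⟨F, hF⟩ := exists_hom_cyclicObj (N := N) hz (by
      rw [← Nat.sub_add_cancel (hm.trans hN), pow_add, mul_smul, hY.x_pow_smul_eq_zero, smul_zero])
    have h1 : f = i ≫ F := by
      refine ext_of_generator huK ?_
      change _ = F.hom.hom (i.hom.hom _)
      rw [hu, map_smul, hF, hzf]
    apply hf
    rw [h1, ← Ext.mk₀_comp_mk₀, ← Ext.comp_assoc_of_third_deg_zero]
    have h2 := hS.extClass_comp
    dsimp only at h2
    rw [h2, Ext.zero_comp]
  have hfu0 : f.hom.hom u ≠ 0 := fun h0 => extend 0 (by simp) (by simp [h0])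
  have hi : Function.Injective i.hom.hom := by
    have := hS.mono_f
    have h2 : Mono ((isFinDimXNilpotent k r ξ).ι.map i) := inferInstance
    exact (ModuleCat.mono_iff_injective _).1 h2
  have hgu : g k r ξ • u = (ξ ^ l * μ) • u := by
    apply hi
    have hik : i.hom.hom ((ξ ^ l * μ) • u) = (ξ ^ l * μ) • i.hom.hom u :=
      (i.hom.hom.restrictScalars k).map_smul _ _
    rw [hik, map_smul, hu, g_smul_x_pow_smul (g_smul_cyclicObjGen μ N)]
  have hgfu : g k r ξ • f.hom.hom u = (ξ ^ l * μ) • f.hom.hom u := by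
    rw [← map_smul, hgu]
    exact (f.hom.hom.restrictScalars k).map_smul _ _
  obtain ⟨t, htm, c, hc, hdeg, hfu⟩ := hY.exists_eq_smul hξ hr hm hgfu hfu0
  -- If `t ≥ l`, then `f u` is divisible by `x ^ l` in the right weight, so `f` extends.
  have htl : t < l := by
    by_contra! H
    obtain ⟨s, rfl⟩ := Nat.exists_eq_add_of_le H
    have h1 : μ = ξ ^ s * ν := by
      rw [pow_add, mul_assoc] at hdeg
      exact mul_left_cancel₀ (pow_ne_zero _ hξ0) hdeg
    refine extend (c • x k r ξ ^ s • y) ?_ ?_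
    · rw [smul_comm_scalar, g_smul_x_pow_smul hY.g_smul, ← h1, smul_comm]
    · rw [hfu, smul_comm_scalar, ← mul_smul, ← pow_add]
  -- If `0 < t < l`, then `x ^ (l - t) • v` has the weight `ν` of `y`. This gives a nonzero map `Y ⟶
  -- X`, or, when `ν = μ`, the equality `ξ ^ (l - t) = 1` with `0 < l - t < r`.
  have ht0 : t = 0 := by
    by_contra ht0
    obtain ⟨s, rfl⟩ := Nat.exists_eq_add_of_le htl.le
    have h1 : ξ ^ s * μ = ν := by
      rw [pow_add, mul_assoc] at hdeg
      exact mul_left_cancel₀ (pow_ne_zero _ hξ0) hdeg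
    rcases hYX with hYX | rfl
    · obtain ⟨F, hF⟩ := hY.exists_linearMap hξ hr hm (y := x k r ξ ^ s • v)
        (by rw [g_smul_x_pow_smul hX.g_smul, h1]) (by
          rw [← mul_smul, ← pow_add, show m + s = (m - t) + (t + s) by lia, pow_add, mul_smul,
            hX.x_pow_smul, smul_zero])
      have h2 := congrArg (fun q => q.hom.hom y) (hYX (mkHom F))
      have h3 : F y = 0 := h2
      exact hX.x_pow_smul_ne s (by lia) (hF ▸ h3)
    · have hy0 : y ≠ 0 := by simpa using hY.x_pow_smul_ne 0 (by lia)
      have hν := pow_eq_one_of_g_smul hY.g_smul hy0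
      have hν0 : ν ≠ 0 := by rintro rfl; simp [hr] at hν
      have h2 : ξ ^ s = ξ ^ 0 := mul_right_cancel₀ hν0 (by rw [h1, pow_zero, one_mul])
      have := hξ.pow_inj (by lia) (by lia) h2
      lia
  subst ht0
  exact ⟨by rw [hdeg, pow_zero, one_mul], htm, c, hc, by rw [hfu, pow_zero, one_smul]⟩

/-- `Ext¹` between orthogonal bricks is at most one-dimensional, and is nonzero only if the
top of the second brick follows the socle of the first one. -/
lemma ext_of_isGenerator (hξ : IsPrimitiveRoot ξ r) (hr : r ≠ 0)
    {X Y : FinDimXNilpotent k r ξ} {v : X.obj} {μ : k} {l : ℕ} (hX : IsGenerator r ξ v μ l)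
    (hl : l ≤ r) {y : Y.obj} {ν : k} {m : ℕ} (hY : IsGenerator r ξ y ν m) (hm : m ≤ r)
    (hYX : (∀ h : Y ⟶ X, h = 0) ∨ ν = μ) {e₁ : Ext X Y 1} (he₁ : e₁ ≠ 0) :
    ν = ξ ^ l * μ ∧ 0 < m ∧ ∀ e : Ext X Y 1, ∃ c : k, c • e₁ = e := by
  have hv0 : v ≠ 0 := by
    rintro rfl
    have h1 : 𝟙 X = 0 := ext_of_generator hX.exists_smul_eq (map_zero _).symm
    apply he₁
    rw [← Ext.mk₀_id_comp e₁, h1, Ext.mk₀_zero, Ext.zero_comp]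
  have hμ := pow_eq_one_of_g_smul hX.g_smul hv0
  obtain ⟨N₁, hN₁⟩ := exists_forall_comp_eq_zero hξ hr hμ hX.g_smul e₁
  have key (e : Ext X Y 1) (he : e ≠ 0) :
      ν = ξ ^ l * μ ∧ 0 < m ∧ ∃ c : k, c • e₁ = e := by
    obtain ⟨N₂, hN₂⟩ := exists_forall_comp_eq_zero hξ hr hμ hX.g_smul e
    -- One cover long enough to kill both classes, so that they come from maps out of the same
    -- kernel and can be compared on its generator.
    obtain ⟨K, i, π, w, hS, u, hπ, hu, huK⟩ := exists_shortExact hξ hr hX hl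
      (N := max r (max N₁ N₂)) (by lia)
    obtain ⟨x₁, hx₁⟩ := Ext.contravariant_sequence_exact₃ hS Y e₁ (hN₁ _ (by lia) π hπ) (add_zero 1)
    obtain ⟨x₂, hx₂⟩ := Ext.contravariant_sequence_exact₃ hS Y e (hN₂ _ (by lia) π hπ) (add_zero 1)
    obtain ⟨f₁, rfl⟩ := (Ext.mk₀_bijective _ _).2 x₁
    obtain ⟨f₂, rfl⟩ := (Ext.mk₀_bijective _ _).2 x₂
    obtain ⟨h1, h2, c₁, hc₁, hf₁⟩ := exists_eq_smul_of_extClass_comp_ne_zero hξ hr hX hl hY hm hYX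
      (by lia) hS hu huK (f := f₁) (by rwa [hx₁])
    obtain ⟨-, -, c₂, hc₂, hf₂⟩ := exists_eq_smul_of_extClass_comp_ne_zero hξ hr hX hl hY hm hYX
      (by lia) hS hu huK (f := f₂) (by rwa [hx₂])
    refine ⟨h1, h2, c₂ * c₁⁻¹, ?_⟩
    have h3 : f₂ = (c₂ * c₁⁻¹) • f₁ := by
      refine ext_of_generator huK ?_
      rw [smul_hom_apply, hf₁, hf₂, smul_smul, inv_mul_cancel_right₀ hc₁]
    rw [← hx₁, ← hx₂, h3, Ext.mk₀_smul, Ext.comp_smul]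
  obtain ⟨h1, h2, -⟩ := key e₁ he₁
  refine ⟨h1, h2, fun e => ?_⟩
  by_cases he : e = 0
  · exact ⟨0, by rw [he, zero_smul]⟩
  · exact (key e he).2.2

end

lemma isGenerator_cyclicObjGen (hξ : ξ ^ r = 1) (N : ℕ) :
    IsGenerator r ξ (cyclicObjGen r ξ 1 N) 1 N where
  g_smul := g_smul_cyclicObjGen 1 N
  x_pow_smul := x_pow_smul_cyclicObjGen 1 N
  x_pow_smul_ne _ hi := x_pow_smul_cyclicGen_ne_zero hξ hi
  exists_smul_eq := exists_smul_cyclicObjGen 1 N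

/-- The weights `ξ ^ t` with `t < r` are distinct, so the weight-`1` space is the line through the
generator, and an endomorphism must preserve it. -/
lemma isBrick_cyclicObj (hξ : IsPrimitiveRoot ξ r) (hr : r ≠ 0) :
    IsBrick k (cyclicObj r ξ 1 r) := by
  have hp := isGenerator_cyclicObjGen hξ.pow_eq_one r
  have hp0 : cyclicObjGen r ξ 1 r ≠ 0 := by simpa using hp.x_pow_smul_ne 0 (by lia)
  constructor
  · intro a b hab
    have h1 : a • cyclicObjGen r ξ 1 r = b • cyclicObjGen r ξ 1 r :=
      congrArg (fun q => q.hom.hom (cyclicObjGen r ξ 1 r)) hab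
    exact smul_left_injective k hp0 h1
  · intro f
    suffices ∃ c : k, f.hom.hom (cyclicObjGen r ξ 1 r) = c • cyclicObjGen r ξ 1 r by
      obtain ⟨c, hc⟩ := this
      refine ⟨c, ext_of_generator hp.exists_smul_eq ?_⟩
      rw [hc]
      rfl
    by_cases h0 : f.hom.hom (cyclicObjGen r ξ 1 r) = 0
    · exact ⟨0, by rw [h0, zero_smul]⟩
    have hg : g k r ξ • f.hom.hom (cyclicObjGen r ξ 1 r) =
        (1 : k) • f.hom.hom (cyclicObjGen r ξ 1 r) := by
      rw [← map_smul, hp.g_smul, one_smul, one_smul]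
    obtain ⟨t, ht, c, -, hdeg, hf⟩ := hp.exists_eq_smul hξ hr le_rfl hg h0
    have ht0 : t = 0 := hξ.pow_inj ht (by lia) (by rw [pow_zero, hdeg, mul_one])
    exact ⟨c, by rw [hf, ht0, pow_zero, one_smul]⟩

lemma homDim_self_of_isBrick {C : Type v} [Category.{u} C] [Abelian C] [Linear k C] {X : C}
    (hX : IsBrick k X) : homDim k X X = 1 := by
  let e : k ≃ₗ[k] (X ⟶ X) := LinearEquiv.ofBijective (LinearMap.toSpanSingleton k _ (𝟙 X)) hX
  rw [homDim, ← e.rank_eq, Module.rank_self, map_one]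

/-- Multiplication by `x ^ r` preserves weights, so the module of length `2r` has the one of length
`r` as both submodule and quotient. -/
lemma exists_ext_cyclicObj_ne_zero [HasExt.{w} (FinDimXNilpotent k r ξ)]
    (hξ : IsPrimitiveRoot ξ r) (hr : r ≠ 0) :
    ∃ e : Ext (cyclicObj r ξ 1 r) (cyclicObj r ξ 1 r) 1, e ≠ 0 := by
  have hp := isGenerator_cyclicObjGen hξ.pow_eq_one r
  have hq := isGenerator_cyclicObjGen hξ.pow_eq_one (r + r)
  have hp0 : cyclicObjGen r ξ 1 r ≠ 0 := by simpa using hp.x_pow_smul_ne 0 (by lia)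
  have hgq : g k r ξ • x k r ξ ^ r • cyclicObjGen r ξ 1 (r + r) =
      (1 : k) • x k r ξ ^ r • cyclicObjGen r ξ 1 (r + r) := by
    rw [g_smul_x_pow_smul hq.g_smul, hξ.pow_eq_one, one_mul]
  have hxq : x k r ξ ^ r • x k r ξ ^ r • cyclicObjGen r ξ 1 (r + r) = 0 := by
    rw [← mul_smul, ← pow_add, hq.x_pow_smul]
  obtain ⟨i, hi⟩ := exists_hom_cyclicObj hgq hxq
  obtain ⟨π, hπ⟩ := exists_hom_cyclicObj (N := r + r) hp.g_smul (by
    rw [pow_add, mul_smul, hp.x_pow_smul, smul_zero])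
  have hinj : Function.Injective i.hom.hom := by
    rw [injective_iff_map_eq_zero]
    intro a ha
    obtain ⟨t, rfl⟩ := hp.exists_smul_eq a
    obtain ⟨c, hc⟩ := exists_smul_eq_sum hp.g_smul hp.x_pow_smul t
    have hik (a : k) (y) : i.hom.hom (a • y) = a • i.hom.hom y :=
      (i.hom.hom.restrictScalars k).map_smul a y
    rw [hc, map_sum] at ha
    simp only [hik, map_smul, hi] at ha
    rw [hc]
    refine Finset.sum_eq_zero fun j hj => ?_
    rw [eq_zero_of_sum_smul_x_pow_smul_eq_zero hξ hr hgq le_rfl (fun j hj => ?_) ha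
      (by simpa using hj), zero_smul]
    rw [← mul_smul, ← pow_add]
    exact hq.x_pow_smul_ne _ (by lia)
  have hiπ : π.hom.hom (x k r ξ ^ r • cyclicObjGen r ξ 1 (r + r)) = 0 := by
    rw [map_smul, hπ, hp.x_pow_smul]
  obtain ⟨w, hS⟩ := shortExact_of_exact i π hinj
    (fun m => by
      obtain ⟨t, rfl⟩ := hp.exists_smul_eq m
      exact ⟨t • cyclicObjGen r ξ 1 (r + r), by rw [map_smul, hπ]⟩)
    (fun m => by
      constructor
      · intro hm
        obtain ⟨s, rfl⟩ := exists_smul_x_pow_smul_eq hξ hr hp le_rfl (by lia) hπ hm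
        exact ⟨s • cyclicObjGen r ξ 1 r, by rw [map_smul, hi]⟩
      · rintro ⟨a, rfl⟩
        obtain ⟨t, rfl⟩ := hp.exists_smul_eq a
        rw [map_smul, map_smul, hi, hiπ, smul_zero])
  refine ⟨hS.extClass, fun h0 => ?_⟩
  -- A zero class would give a retraction `F` of `i`. But `i` sends the generator into the image of
  -- `x ^ r`, which acts as zero on the target of `F`.
  obtain ⟨x₂, hx₂⟩ := Ext.contravariant_sequence_exact₁ hS (Y := cyclicObj r ξ 1 r)
    (Ext.mk₀ (𝟙 _)) (add_zero 1) (by rw [h0, Ext.zero_comp])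
  obtain ⟨F, rfl⟩ := (Ext.mk₀_bijective _ _).2 x₂
  rw [Ext.mk₀_comp_mk₀] at hx₂
  have h1 := congrArg (fun q => q.hom.hom (cyclicObjGen r ξ 1 r)) ((Ext.mk₀_bijective _ _).1 hx₂)
  have h2 : F.hom.hom (i.hom.hom (cyclicObjGen r ξ 1 r)) = cyclicObjGen r ξ 1 r := h1
  rw [hi, map_smul, hp.x_pow_smul_eq_zero] at h2
  exact hp0 h2.symm

end ExtComputation

/-! ### Dimension counts for `Hom` and `Ext`. -/

section Dimension

open Abelian

variable {k : Type u} [Field k] {C : Type v} [Category.{w} C] [Abelian C] [Linear k C] {X Y : C}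

lemma extDim_le_one_of_forall_exists_smul {n : ℕ}
    (h : letI := HasExt.standard C; ∃ e₁ : Ext X Y n, ∀ e, ∃ c : k, c • e₁ = e) :
    extDim k n X Y ≤ 1 := by
  rw [extDim, ← map_one Cardinal.toENat]
  exact Cardinal.toENat.monotone' (rank_le_one_iff.2 h)

lemma extDim_ne_zero_iff {n : ℕ} :
    extDim k n X Y ≠ 0 ↔ letI := HasExt.standard C; ∃ e : Ext X Y n, e ≠ 0 := by
  rw [extDim, Ne, Cardinal.toENat_eq_zero, rank_zero_iff_forall_zero]
  push Not
  rfl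

lemma eq_zero_of_homDim_eq_zero (h : homDim k X Y = 0) (f : X ⟶ Y) : f = 0 := by
  rw [homDim, Cardinal.toENat_eq_zero, rank_zero_iff_forall_zero] at h
  exact h f

end Dimension

/-! ### Row sums of the adjacency matrix, and the extremal brick. -/

section Main

open Abelian
open scoped ModuleCat

variable {k : Type u} [Field k] {r : ℕ} {ξ : k}

lemma sum_extDim_le_one (hξ : IsPrimitiveRoot ξ r) (hr : r ≠ 0) {n : ℕ}
    {X : Fin n → FinDimXNilpotent k r ξ} (hX : IsBrickSet k X) (i : Fin n) :
    ∑ j, extDim k 1 (X i) (X j) ≤ 1 := by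
  let := HasExt.standard (FinDimXNilpotent k r ξ)
  choose v μ l hl hgen using fun j => exists_isGenerator_of_isBrick hξ hr (hX.1 j)
  have hzero {a b : Fin n} (hab : a ≠ b) (f : X a ⟶ X b) : f = 0 :=
    eq_zero_of_homDim_eq_zero (k := k) (by rw [hX.2, if_neg hab]) f
  have key (j : Fin n) (hj : extDim k 1 (X i) (X j) ≠ 0) :
      μ j = ξ ^ l i * μ i ∧ 0 < l j ∧ extDim k 1 (X i) (X j) ≤ 1 := by
    obtain ⟨e, he⟩ := extDim_ne_zero_iff.1 hj
    obtain ⟨h1, h2, h3⟩ := ext_of_isGenerator hξ hr (hgen i) (hl i) (hgen j) (hl j) (by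
      by_cases hij : j = i
      · exact Or.inr (by rw [hij])
      · exact Or.inl (hzero hij)) he
    exact ⟨h1, h2, extDim_le_one_of_forall_exists_smul ⟨e, h3⟩⟩
  have huniq (a b : Fin n) (ha : extDim k 1 (X i) (X a) ≠ 0) (hb : extDim k 1 (X i) (X b) ≠ 0)
      (hab : l a ≤ l b) : a = b := by
    by_contra hne
    obtain ⟨hμa, hla, -⟩ := key a ha
    obtain ⟨hμb, -, -⟩ := key b hb
    -- Both tops have weight `ξ ^ l i * μ i`, so the longer module maps onto the shorter,
    -- contradicting orthogonality.
    obtain ⟨f, hf⟩ := (hgen b).exists_linearMap hξ hr (hl b) (y := v a)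
      (by rw [(hgen a).g_smul, hμa, hμb])
      (by rw [← Nat.sub_add_cancel hab, pow_add, mul_smul, (hgen a).x_pow_smul, smul_zero])
    have h1 := congrArg (fun q => q.hom.hom (v b)) (hzero (Ne.symm hne) (mkHom f))
    have h2 : f (v b) = 0 := h1
    exact (hgen a).x_pow_smul_ne 0 hla (by rw [pow_zero, one_smul, ← hf, h2])
  by_cases H : ∃ j, extDim k 1 (X i) (X j) ≠ 0
  · obtain ⟨j, hj⟩ := H
    rw [Finset.sum_eq_single_of_mem j (Finset.mem_univ j)]
    · exact (key j hj).2.2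
    · intro j' _ hne
      by_contra hj'
      rcases le_total (l j) (l j') with h | h
      · exact hne (huniq _ _ hj hj' h).symm
      · exact hne (huniq _ _ hj' hj h)
  · push Not at H
    simp [H]

lemma extDim_cyclicObj (hξ : IsPrimitiveRoot ξ r) (hr : r ≠ 0) :
    extDim k 1 (cyclicObj r ξ 1 r) (cyclicObj r ξ 1 r) = 1 := by
  let := HasExt.standard (FinDimXNilpotent k r ξ)
  obtain ⟨e, he⟩ := exists_ext_cyclicObj_ne_zero hξ hr
  have hp := isGenerator_cyclicObjGen hξ.pow_eq_one r
  refine le_antisymm (extDim_le_one_of_forall_exists_smul ⟨e,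
    (ext_of_isGenerator hξ hr hp le_rfl hp le_rfl (Or.inr rfl) he).2.2⟩) ?_
  exact Order.one_le_iff_ne_zero.2 (extDim_ne_zero_iff.2 ⟨e, he⟩)

end Main

end FrobeniusPerron

end

theorem corollary2p12 {k : Type u} [Field k] [IsAlgClosed k] (r : ℕ) (hr : 1 ≤ r) (ξ : k)
    (hξ : IsPrimitiveRoot ξ r) :
    FrobeniusPerron.fpdim k (FrobeniusPerron.FinDimXNilpotent k r ξ) = 1 := by
  have hr0 : r ≠ 0 := by lia
  refine le_antisymm ?_ ?_
  · refine iSup₂_le fun n _ => iSup₂_le fun X hX =>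
      FrobeniusPerron.matrixSpectralRadius_le_one fun i => ?_
    exact FrobeniusPerron.sum_extDim_le_one hξ hr0 hX i
  · have hB := FrobeniusPerron.isBrick_cyclicObj hξ hr0
    refine le_trans ?_ (le_iSup₂_of_le 1 le_rfl
      (le_iSup₂_of_le (fun _ => FrobeniusPerron.cyclicObj r ξ 1 r) ?_ le_rfl))
    · exact FrobeniusPerron.one_le_matrixSpectralRadius
        (FrobeniusPerron.extDim_cyclicObj hξ hr0)
    · refine ⟨fun _ => hB, fun i j => ?_⟩
      rw [if_pos (Subsingleton.elim i j)]
      exact FrobeniusPerron.homDim_self_of_isBrick hB
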